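/- Let $L>0$ and $\mu>0$. For small $\gamma>0$ put $L_\gamma=\frac{2}{\gamma}\Big(\sqrt{1+\tfrac{\gamma L}{2}}-\sqrt{1-\tfrac{\gamma L}{2}}\Big)$ and $$\delta(x)=-\frac{3L_\gamma}{4L}\,\frac{\gamma}{\sqrt{1+\frac{\gamma L}{2}}-\frac{\gamma L_\gamma x}{2L}}\quad(x\in[0,L]),\qquad \Lambda=\begin{pmatrix}1&0\\0&-1\end{pmatrix},\qquad J=\begin{pmatrix}0&\frac13\\-\frac13&0\end{pmatrix}.$$ Consider the target system with boundary damping, for $z=(z_1,z_2)$ with values in $\mathbb{C}^2$, $$\partial_t z+\Lambda\partial_x z+\delta(x)Jz=0,\qquad z_1(t,0)=-e^{-2\mu L}z_2(t,0),\qquad z_2(t,L)=-z_1(t,L),\qquad t\ge 0,\ x\in(0,L).\tag{1}$$ For $p\in\mathbb{N}=\{0,1,2,\dots\}$, a function $z_0\in H^p((0,L);\mathbb{C}^2)$ is called compatible if $z_0,\widetilde{\mathcal A}z_0,\dots,\widetilde{\mathcal A}^{p-1}z_0$ satisfy the boundary conditions in (1), where $\widetilde{\mathcal A}=\Lambda\partial_x+\delta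 J$ (no condition if $p=0$). We say that (1) is exponentially stable in $H^p$ with decay rate $\lambda$ if there is a constant $C>0$ such that for every compatible $z_0\in H^p((0,L);\mathbb{C}^2)$ the system (1) has a unique solution $z\in C^0([0,+\infty);H^p((0,L);\mathbb{C}^2))$ with $z(0,\cdot)=z_0$, and $$\|z(t,\cdot)\|_{H^p}\le Ce^{-\lambda t}\|z_0\|_{H^p}\qquad\text{for all }t\ge 0.$$ Here solutions are understood in the weak sense (tested against $C^1$ functions on $[0,L]$ satisfying the adjoint boundary conditions); for $p\ge1$ the solution moreover satisfies the boundary conditions in the sense of traces and the equation in $L^2$ for every $t\ge 0$. **Proposition.** There is a continuous, decreasing function $\gamma_s:(0,\mu)\to(0,+\infty)$ such that for every $\lambda_0\in(0,\mu)$, every $\gamma\in(0,\gamma_s(\lambda_0))$, every $\lambda\in[0,\lambda_0]$ and every $p\in\mathbb{N}$, the system (1) is exponentially stable in $H^p$ with decay rate $\lambda$. -/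

import Mathlib

open MeasureTheory Set
open scoped ContDiff

noncomputable section

namespace WaterTank

/-- `L²((0,L); ℂ²)`. -/
abbrev L2 (L : ℝ) : Type :=
  Lp (EuclideanSpace ℂ (Fin 2)) 2 (volume.restrict (Ioo (0 : ℝ) L))

/-- `g` is the weak derivative of `f` on `(0,L)`: for every real test function
`φ ∈ C_c^∞((0,L))`, `∫ φ' f = - ∫ φ g`. -/
def HasWeakDeriv {L : ℝ} (f g : L2 L) : Prop :=
  ∀ φ : ℝ → ℝ, ContDiff ℝ ∞ φ → HasCompactSupport φ → tsupport φ ⊆ Ioo 0 L →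
    ∫ x in Ioo 0 L, deriv φ x • f x = - ∫ x in Ioo 0 L, φ x • g x

theorem integrable_smul_L2 {L : ℝ} {φ : ℝ → ℝ} (hφ : Continuous φ)
    (hc : HasCompactSupport φ) (f : L2 L) :
    Integrable (fun x => φ x • f x) (volume.restrict (Ioo (0 : ℝ) L)) := by
  have hf : Integrable (fun x => f x) (volume.restrict (Ioo (0 : ℝ) L)) :=
    (Lp.memLp f).integrable (by norm_num)
  obtain ⟨C, hC⟩ := hc.exists_bound_of_continuous hφ
  exact hf.bdd_smul C hφ.aestronglyMeasurable (Filter.Eventually.of_forall hC)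

theorem hasWeakDeriv_zero (L : ℝ) : HasWeakDeriv (0 : L2 L) 0 := by
  intro φ _ _ _
  have h0 : ∀ ψ : ℝ → ℝ, ∫ x in Ioo 0 L, ψ x • (0 : L2 L) x = 0 := by
    intro ψ
    rw [integral_eq_zero_of_ae]
    filter_upwards [Lp.coeFn_zero (EuclideanSpace ℂ (Fin 2)) 2
      (volume.restrict (Ioo (0 : ℝ) L))] with x hx
    rw [hx]
    simp
  rw [h0, h0, neg_zero]

theorem HasWeakDeriv.add {L : ℝ} {f g f' g' : L2 L} (hf : HasWeakDeriv f f')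
    (hg : HasWeakDeriv g g') : HasWeakDeriv (f + g) (f' + g') := by
  intro φ hφ hc hs
  have key : ∀ (ψ : ℝ → ℝ), Continuous ψ → HasCompactSupport ψ → ∀ a b : L2 L,
      ∫ x in Ioo 0 L, ψ x • (a + b : L2 L) x
        = (∫ x in Ioo 0 L, ψ x • a x) + (∫ x in Ioo 0 L, ψ x • b x) := by
    intro ψ hψ hψc a b
    rw [← integral_add (integrable_smul_L2 hψ hψc a) (integrable_smul_L2 hψ hψc b)]
    apply integral_congr_ae
    filter_upwards [Lp.coeFn_add a b] with x hx
    rw [hx, Pi.add_apply, smul_add]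
  rw [key _ (hφ.continuous_deriv (by simp)) hc.deriv, key _ hφ.continuous hc,
    hf φ hφ hc hs, hg φ hφ hc hs, neg_add]

theorem HasWeakDeriv.smul {L : ℝ} {f f' : L2 L} (c : ℂ) (hf : HasWeakDeriv f f') :
    HasWeakDeriv (c • f) (c • f') := by
  intro φ hφ hc hs
  have key : ∀ (ψ : ℝ → ℝ) (a : L2 L),
      ∫ x in Ioo 0 L, ψ x • (c • a : L2 L) x = c • ∫ x in Ioo 0 L, ψ x • a x := by
    intro ψ a
    rw [← integral_smul]
    apply integral_congr_ae
    filter_upwards [Lp.coeFn_smul c a] with x hx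
    rw [hx, Pi.smul_apply, smul_comm]
  rw [key, key, hf φ hφ hc hs, smul_neg]

/-- The Sobolev space `H^p((0,L); ℂ²)`. Since weak derivatives are unique, an element is a function
in `L²` recorded together with its successive weak derivatives up to order `p`, all in `L²`. The
norm inherited from the `ℓ²`-product is `(∑_{k ≤ p} ‖∂ₓᵏ f‖²_{L²})^{1/2}`. -/
def sobolev (L : ℝ) (p : ℕ) : Submodule ℂ (PiLp 2 (fun _ : Fin (p + 1) => L2 L)) where
  carrier := {u | ∀ k : Fin p, HasWeakDeriv (u k.castSucc) (u k.succ)}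
  zero_mem' := fun _ => hasWeakDeriv_zero L
  add_mem' := fun ha hb k => (ha k).add (hb k)
  smul_mem' := fun c _ ha k => (ha k).smul c

/-- `H^p((0,L); ℂ²)` as a normed space. -/
abbrev Hp (L : ℝ) (p : ℕ) : Type := sobolev L p

/-- The function in `L²` underlying an element of `H^p`. -/
def Hp.toL2 {L : ℝ} {p : ℕ} (u : Hp L p) : L2 L :=
  (u : PiLp 2 (fun _ : Fin (p + 1) => L2 L)) 0

/-- `L_γ = (2/γ) (√(1 + γL/2) - √(1 - γL/2))`. -/
def Lgam (L γ : ℝ) : ℝ := 2 / γ * (√(1 + γ * L / 2) - √(1 - γ * L / 2))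

/-- The coupling coefficient
`δ(x) = - (3 L_γ / (4 L)) γ / (√(1 + γL/2) - γ L_γ x / (2L))`. -/
def delta (L γ x : ℝ) : ℝ :=
  -(3 * Lgam L γ / (4 * L)) * (γ / (√(1 + γ * L / 2) - γ * Lgam L γ * x / (2 * L)))

/-- `Λ d + δ(x) J u` with `Λ = diag(1,-1)` and `J = ((0, 1/3), (-1/3, 0))`, where `u` stands for the
value at `x` of a function and `d` for the value of its derivative. -/
def diffExpr (L γ x : ℝ) (u d : EuclideanSpace ℂ (Fin 2)) : EuclideanSpace ℂ (Fin 2) :=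
  !₂[d 0 + (delta L γ x : ℂ) * (1 / 3 * u 1), -d 1 + (delta L γ x : ℂ) * (-(1 / 3) * u 0)]

/-- The boundary conditions `f₁(0) = -e^{-2μL} f₂(0)` and `f₂(L) = -f₁(L)`, read on the
continuous representative `u` of `f` on `[0,L]`. -/
def BoundaryCond (L μ : ℝ) (f : L2 L) : Prop :=
  ∃ u : ℝ → EuclideanSpace ℂ (Fin 2), ContinuousOn u (Icc 0 L) ∧
    (f =ᵐ[volume.restrict (Ioo (0 : ℝ) L)] u) ∧
    u 0 0 = -(Real.exp (-2 * μ * L) : ℂ) * u 0 1 ∧ u L 1 = -u L 0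

/-- `f` lies in the domain of `Ã = Λ ∂ₓ + δ J`, i.e. `f ∈ H¹` and `f` satisfies the boundary
conditions, and `g = Ã f`. -/
def TargetOp (L μ γ : ℝ) (f g : L2 L) : Prop :=
  ∃ d : L2 L, HasWeakDeriv f d ∧ BoundaryCond L μ f ∧
    g =ᵐ[volume.restrict (Ioo (0 : ℝ) L)] fun x => diffExpr L γ x (f x) (d x)

/-- Compatibility conditions of order `p`: `f`, `Ã f`, …, `Ã^{p-1} f` are defined and all satisfy
the boundary conditions (no condition if `p = 0`). -/
def Compatible (L μ γ : ℝ) : ℕ → L2 L → Prop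
  | 0, _ => True
  | p + 1, f => ∃ g : L2 L, TargetOp L μ γ f g ∧ Compatible L μ γ p g

/-- `∫₀ᴸ ⟨f(x), ψ(x)⟩ dx`, conjugate-linear in `ψ`. -/
def pairing {L : ℝ} (f : L2 L) (ψ : ℝ → EuclideanSpace ℂ (Fin 2)) : ℂ :=
  ∫ x in Ioo 0 L, inner ℂ (ψ x) (f x)

/-- `z ∈ C⁰([0,∞); H^p)` is a weak solution of
`∂ₜz + Λ ∂ₓz + δ J z = 0`, `z₁(t,0) = -e^{-2μL} z₂(t,0)`, `z₂(t,L) = -z₁(t,L)`, `z(0) = z₀`.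
The test functions are the `C¹` functions on `[0,L]` satisfying the adjoint boundary conditions;
the adjoint of `-(Λ ∂ₓ + δ J)` is the same expression `Λ ∂ₓ + δ J`, as `J` is antisymmetric. -/
structure IsWeakSolution (L μ γ : ℝ) {p : ℕ} (z₀ : Hp L p) (z : ℝ → Hp L p) : Prop where
  continuousOn : ContinuousOn z (Ici 0)
  initial : z 0 = z₀
  weak : ∀ ψ : ℝ → EuclideanSpace ℂ (Fin 2), ContDiff ℝ 1 ψ →
    ψ 0 0 = -(Real.exp (2 * μ * L) : ℂ) * ψ 0 1 → ψ L 1 = -ψ L 0 →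
    ∀ t : ℝ, 0 ≤ t →
      pairing (z t).toL2 ψ = pairing z₀.toL2 ψ
        + ∫ s in (0 : ℝ)..t, pairing (z s).toL2 (fun x => diffExpr L γ x (ψ x) (deriv ψ x))

/-- The strong form: for every `t ≥ 0`, `z(t) ∈ H¹` satisfies the boundary conditions and
`∂ₜz = -(Λ ∂ₓz + δ J z)` in `L²`. -/
def SolvesStrongly (L μ γ : ℝ) {p : ℕ} (z : ℝ → Hp L p) : Prop :=
  ∀ t : ℝ, 0 ≤ t → ∃ g : L2 L, TargetOp L μ γ (z t).toL2 g ∧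
    HasDerivWithinAt (fun s => (z s).toL2) (-g) (Ici 0) t

/-- Exponential stability of the target system for the `H^p` norm with decay rate `lam`: for all
compatible data in `H^p` there is a unique solution in `C⁰([0,∞); H^p)` (which, if `p ≥ 1`,
satisfies the equation and the boundary conditions in the strong sense), and
`‖z(t)‖ ≤ C e^{-lam t} ‖z₀‖` with `C` independent of the data. -/
def ExpStable (L μ γ : ℝ) (p : ℕ) (lam : ℝ) : Prop :=
  ∃ C : ℝ, 0 < C ∧ ∀ z₀ : Hp L p, Compatible L μ γ p z₀.toL2 →
    ∃ z : ℝ → Hp L p, IsWeakSolution L μ γ z₀ z ∧ (1 ≤ p → SolvesStrongly L μ γ z) ∧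
      (∀ y : ℝ → Hp L p, IsWeakSolution L μ γ z₀ y → ∀ t : ℝ, 0 ≤ t → y t = z t) ∧
      ∀ t : ℝ, 0 ≤ t → ‖z t‖ ≤ C * Real.exp (-lam * t) * ‖z₀‖

end WaterTank

end

/-! Without the coupling, `Λ ∂ₓ` under the boundary conditions of (1) has the eigenvalues `μ +
iπn/L`, `n ∈ ℤ`, all on one vertical line. Its eigenfunctions `(e^{κx}, -e^{2μL} e^{-κx})` become,
after multiplication by the weight `diag(e^{-μx}, -e^{-μ(2L-x)})`, the functions `(e^{iπnx/L},
e^{-iπnx/L})`. These form an orthogonal basis of `L²((0,L); ℂ²)`: reflecting the second component to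
`(-L,0)` turns them into the Fourier basis of `(-L,L)`. So in weighted coordinates the uncoupled
flow is `e^{-μt}` times a unitary group (`inner_modeVec_weight_lamOp`, `modeBasis`).

The coupling `δJ` is a bounded perturbation `B`, and in weighted coordinates `‖B‖ ≤ 3Mγ` with `M`
depending only on `L` and `μ`. Removing the unitary group and the factor `e^{-μt}` leaves a bounded
nonautonomous equation, solved by a contraction argument; Gronwall's inequality gives the decay rate
`μ - ‖B‖` (`isModalSol_iff`, `IsModalSol.norm_le`). Weak solutions are unique because the adjoint
eigenfunctions are admissible test functions and yield the equation of every Fourier coefficient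
(`SolvesWeakly.isModalSol`).

Passing to `H^p` costs no decay. The flow commutes with `Ã` (`evol_graph`), so `Ã z(t)` is the
solution issued from `Ã z₀`. Since `∂ₓz = Λ(Ã z - δJz)`, the bounds on `z` and `Ã z` in `H^p` give a
bound on `z` in `H^{p+1}` with the same exponent (`exists_targetEvol_Hp`). Only the constant depends
on `p`, so one threshold for `γ` serves all `p`. -/

namespace WaterTank

/-! ### Linear evolution equations on a Hilbert space, diagonal up to a bounded perturbation -/

section Volterra

variable {K : Type*} [NormedAddCommGroup K] [NormedSpace ℝ K] [CompleteSpace K]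

theorem integral_exp_mul_le {M t : ℝ} :
    Real.exp (-(2 * M) * t) * ∫ s in (0 : ℝ)..t, M * Real.exp (2 * M * s) ≤ 1 / 2 := by
  have h : ∫ s in (0 : ℝ)..t, M * Real.exp (2 * M * s)
      = Real.exp (2 * M * t) / 2 - Real.exp (2 * M * 0) / 2 := by
    apply intervalIntegral.integral_eq_sub_of_hasDerivAt
    · intro s _
      have h1 : HasDerivAt (fun s : ℝ => 2 * M * s) (2 * M) s := by
        simpa using (hasDerivAt_id s).const_mul (2 * M)
      convert! (h1.exp.div_const 2) using 1
      ring
    · exact (by fun_prop : Continuous fun s : ℝ => M * Real.exp (2 * M * s)).intervalIntegrable _ _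
  have h2 : Real.exp (-(2 * M) * t) * Real.exp (2 * M * t) = 1 := by
    rw [← Real.exp_add]; simp
  rw [h, mul_sub]
  have := Real.exp_pos (-(2 * M) * t)
  simp only [mul_zero, Real.exp_zero]
  linarith

/-- Global solvability of the integral equation `v(t) = x₀ + ∫₀ᵗ C(s) v(s) ds` for a globally
Lipschitz continuous right-hand side. -/
theorem exists_volterra {C : ℝ → K → K} {M : ℝ} (hM : 0 < M)
    (hC : Continuous fun q : ℝ × K => C q.1 q.2) (h0 : ∀ s, C s 0 = 0)
    (hL : ∀ s x y, ‖C s x - C s y‖ ≤ M * ‖x - y‖) (x₀ : K) :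
    ∃ v : ℝ → K, Continuous v ∧ ∀ t, 0 ≤ t → v t = x₀ + ∫ s in (0 : ℝ)..t, C s (v s) := by
  -- The unknown is written as `e^{2Ms} f(s)` with `f` bounded. In this weighted norm the integral
  -- operator has Lipschitz constant `1/2` on the whole half-line, so a single fixed point gives a
  -- global solution.
  set w : BoundedContinuousFunction ℝ K → ℝ → K := fun f s => Real.exp (2 * M * s) • f s with hw
  have hwc : ∀ f, Continuous (w f) := fun f => by
    have := f.continuous
    fun_prop
  have hcw : ∀ f, Continuous fun s => C s (w f s) := fun f =>
    hC.comp (continuous_id.prodMk (hwc f))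
  have hbd : ∀ f g : BoundedContinuousFunction ℝ K, ∀ t : ℝ, 0 ≤ t →
      Real.exp (-(2 * M) * t) * ‖∫ s in (0 : ℝ)..t, (C s (w f s) - C s (w g s))‖
        ≤ 1 / 2 * ‖f - g‖ := by
    intro f g t ht
    have h1 : ‖∫ s in (0 : ℝ)..t, (C s (w f s) - C s (w g s))‖
        ≤ ∫ s in (0 : ℝ)..t, M * Real.exp (2 * M * s) * ‖f - g‖ := by
      apply intervalIntegral.norm_integral_le_of_norm_le ht
      · refine Filter.Eventually.of_forall fun s _ => (hL s _ _).trans ?_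
        rw [mul_assoc]
        refine mul_le_mul_of_nonneg_left ?_ hM.le
        rw [hw]
        simp only
        rw [← smul_sub, norm_smul, Real.norm_of_nonneg (Real.exp_pos _).le]
        exact mul_le_mul_of_nonneg_left ((f - g).norm_coe_le_norm s) (Real.exp_pos _).le
      · exact (by fun_prop : Continuous fun s : ℝ =>
          M * Real.exp (2 * M * s) * ‖f - g‖).intervalIntegrable _ _
    rw [intervalIntegral.integral_mul_const] at h1
    calc _ ≤ Real.exp (-(2 * M) * t) * ((∫ s in (0 : ℝ)..t, M * Real.exp (2 * M * s)) * ‖f - g‖) :=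
          mul_le_mul_of_nonneg_left h1 (Real.exp_pos _).le
      _ ≤ _ := by
        rw [← mul_assoc]
        exact mul_le_mul_of_nonneg_right integral_exp_mul_le (norm_nonneg _)
  have hw0 : ∀ s, C s (w 0 s) = 0 := fun s => by simp [hw, h0]
  -- Negative times are frozen at `0`, since the contraction estimate holds only for `t ≥ 0`.
  let Φ : BoundedContinuousFunction ℝ K → BoundedContinuousFunction ℝ K := fun f =>
    BoundedContinuousFunction.ofNormedAddCommGroup
      (fun t => Real.exp (-(2 * M) * max t 0) • (x₀ + ∫ s in (0 : ℝ)..max t 0, C s (w f s)))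
      (by
        have h1 : Continuous fun t : ℝ => ∫ s in (0 : ℝ)..t, C s (w f s) :=
          intervalIntegral.continuous_primitive (fun a b => (hcw f).intervalIntegrable a b) 0
        have h2 : Continuous fun t : ℝ => ∫ s in (0 : ℝ)..max t 0, C s (w f s) :=
          h1.comp (continuous_id.max continuous_const)
        fun_prop)
      (‖x₀‖ + 1 / 2 * ‖f‖)
      (by
        intro t
        have ht : 0 ≤ max t 0 := le_max_right _ _
        rw [smul_add]
        refine (norm_add_le _ _).trans (add_le_add ?_ ?_)
        · rw [norm_smul, Real.norm_of_nonneg (Real.exp_pos _).le]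
          refine mul_le_of_le_one_left (norm_nonneg _) (Real.exp_le_one_iff.2 ?_)
          nlinarith
        · rw [norm_smul, Real.norm_of_nonneg (Real.exp_pos _).le]
          simpa [hw0] using hbd f 0 _ ht)
  have hΦ : ContractingWith (1 / 2) Φ := by
    refine ⟨by norm_num, LipschitzWith.of_dist_le_mul fun f g => ?_⟩
    rw [BoundedContinuousFunction.dist_le (by positivity)]
    intro t
    have ht : 0 ≤ max t 0 := le_max_right _ _
    have := hbd f g _ ht
    rw [dist_eq_norm, dist_eq_norm]
    simp only [Φ, BoundedContinuousFunction.coe_ofNormedAddCommGroup]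
    rw [← smul_sub, add_sub_add_left_eq_sub, ← intervalIntegral.integral_sub
      ((hcw f).intervalIntegrable _ _) ((hcw g).intervalIntegrable _ _), norm_smul,
      Real.norm_of_nonneg (Real.exp_pos _).le]
    simpa using this
  set f := hΦ.fixedPoint with hf
  refine ⟨w f, hwc f, fun t ht => ?_⟩
  have h1 : f t = Φ f t := by rw [hf, hΦ.fixedPoint_isFixedPt.eq]
  simp only [Φ, BoundedContinuousFunction.coe_ofNormedAddCommGroup, max_eq_left ht] at h1
  rw [hw]
  simp only
  rw [h1, smul_smul, ← Real.exp_add]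
  simp [hw]

theorem hasDerivWithinAt_volterra {F : ℝ → K} {v : ℝ → K} {x₀ : K} (hF : ContinuousOn F (Ici 0))
    (hv : ∀ t, 0 ≤ t → v t = x₀ + ∫ s in (0 : ℝ)..t, F s) {t : ℝ} (ht : 0 ≤ t) :
    HasDerivWithinAt v (F t) (Ici 0) t := by
  -- `F` is continuous on the half-line only; a constant extension to the left makes the fundamental
  -- theorem of calculus applicable at `t = 0` too.
  set G : ℝ → K := fun s => F (max s 0) with hG
  have hGc : Continuous G := hF.comp_continuous (by fun_prop) (fun s => le_max_right s 0)
  have h1 : HasDerivAt (fun t => x₀ + ∫ s in (0 : ℝ)..t, G s) (G t) t :=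
    (intervalIntegral.integral_hasDerivAt_right (hGc.intervalIntegrable _ _)
      (hGc.stronglyMeasurableAtFilter _ _) hGc.continuousAt).const_add x₀
  have h2 : ∀ r, 0 ≤ r → v r = x₀ + ∫ s in (0 : ℝ)..r, G s := fun r hr => by
    rw [hv r hr]
    congr 1
    refine intervalIntegral.integral_congr fun s hs => ?_
    rw [uIcc_of_le hr] at hs
    simp [hG, max_eq_left hs.1]
  have h3 : G t = F t := by simp [hG, max_eq_left ht]
  rw [← h3]
  exact h1.hasDerivWithinAt.congr (fun r hr => h2 r hr) (h2 t ht)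

theorem eq_add_integral_of_hasDerivWithinAt {F v : ℝ → K} (hF : ContinuousOn F (Ici 0))
    (hv : ∀ t, 0 ≤ t → HasDerivWithinAt v (F t) (Ici 0) t) {t : ℝ} (ht : 0 ≤ t) :
    v t = v 0 + ∫ s in (0 : ℝ)..t, F s := by
  have hs : uIcc 0 t ⊆ Ici 0 := by
    rw [uIcc_of_le ht]
    exact Icc_subset_Ici_self
  rw [intervalIntegral.integral_eq_sub_of_hasDeriv_right_of_le ht (f := v)]
  · abel
  · exact fun s hs => ((hv s hs.1).mono Icc_subset_Ici_self).continuousWithinAt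
  · intro s hs
    exact (hv s hs.1.le).mono (fun r hr => hs.1.le.trans (le_of_lt hr))
  · exact (hF.mono hs).intervalIntegrable

/-- Growth bound for `v' = C(t) v` with `‖C(t)‖ ≤ M`. -/
theorem norm_le_exp_of_volterra {F v : ℝ → K} {x₀ : K} {M : ℝ} (hF : ContinuousOn F (Ici 0))
    (hv : ∀ t, 0 ≤ t → v t = x₀ + ∫ s in (0 : ℝ)..t, F s)
    (hb : ∀ t, 0 ≤ t → ‖F t‖ ≤ M * ‖v t‖) {t : ℝ} (ht : 0 ≤ t) :
    ‖v t‖ ≤ Real.exp (M * t) * ‖x₀‖ := by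
  have hd := fun s hs => hasDerivWithinAt_volterra hF hv (t := s) hs
  have h0 : v 0 = x₀ := by simpa using hv 0 le_rfl
  have := norm_le_gronwallBound_of_norm_deriv_right_le (f := v) (f' := F) (δ := ‖x₀‖) (K := M)
    (ε := 0) (a := 0) (b := t)
    (fun s hs => ((hd s hs.1).mono Icc_subset_Ici_self).continuousWithinAt)
    (fun s hs => (hd s hs.1).mono (Ici_subset_Ici.2 hs.1)) (by rw [h0])
    (fun s hs => by simpa using hb s hs.1) t ⟨ht, le_rfl⟩
  rw [gronwallBound_ε0, sub_zero, mul_comm] at this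
  exact this

end Volterra

/-! ### Unitary groups that are diagonal in a Hilbert basis. -/

section Rotation

variable {ι K : Type*} [NormedAddCommGroup K] [InnerProductSpace ℂ K]

local notation "⟪" x ", " y "⟫" => inner ℂ x y

theorem ext_inner_hilbertBasis (b : HilbertBasis ι ℂ K) {x y : K}
    (h : ∀ n, ⟪b n, x⟫ = ⟪b n, y⟫) : x = y := by
  apply b.repr.injective
  ext n
  rw [b.repr_apply_apply, b.repr_apply_apply, h]

/-- The unimodular number `exp(-iθt)`. -/
noncomputable def phase (θ t : ℝ) : ℂ := Complex.exp (-(θ * t : ℝ) * Complex.I)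

theorem phase_mul_phase_neg (θ t : ℝ) : phase θ (-t) * phase θ t = 1 := by
  simp [phase, ← Complex.exp_add]

theorem conj_phase (θ t : ℝ) : (starRingEnd ℂ) (phase θ t) = phase θ (-t) := by
  simp [phase, ← Complex.exp_conj]

theorem orthonormal_phase_smul (b : HilbertBasis ι ℂ K) (θ : ι → ℝ) (t : ℝ) :
    Orthonormal ℂ fun n => phase (θ n) t • b n := by
  classical
  rw [orthonormal_iff_ite]
  intro i j
  rw [inner_smul_left, inner_smul_right, orthonormal_iff_ite.1 b.orthonormal i j, conj_phase]
  split_ifs with h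
  · rw [h, mul_one, phase_mul_phase_neg]
  · simp

variable [CompleteSpace K]

/-- The Hilbert basis `exp(-iθ_n t) b_n`. -/
noncomputable def rotBasis (b : HilbertBasis ι ℂ K) (θ : ι → ℝ) (t : ℝ) : HilbertBasis ι ℂ K :=
  HilbertBasis.mkOfOrthogonalEqBot (orthonormal_phase_smul b θ t) (by
    rw [Submodule.eq_bot_iff]
    intro x hx
    apply ext_inner_hilbertBasis b
    intro n
    have h := (Submodule.mem_orthogonal _ _).1 hx _ (Submodule.subset_span ⟨n, rfl⟩)
    rw [inner_smul_left, mul_eq_zero] at h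
    rw [inner_zero_right]
    refine h.resolve_left ?_
    rw [conj_phase]
    exact Complex.exp_ne_zero _)

/-- The unitary group with `b_n ↦ exp(-iθ_n t) b_n`. -/
noncomputable def rot (b : HilbertBasis ι ℂ K) (θ : ι → ℝ) (t : ℝ) : K ≃ₗᵢ[ℂ] K :=
  b.repr.trans (rotBasis b θ t).repr.symm

variable (b : HilbertBasis ι ℂ K) (θ : ι → ℝ)

theorem inner_rot (t : ℝ) (n : ι) (x : K) :
    ⟪b n, rot b θ t x⟫ = phase (θ n) t * ⟪b n, x⟫ := by
  have h : (rotBasis b θ t).repr (rot b θ t x) n = b.repr x n := by simp [rot]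
  rw [HilbertBasis.repr_apply_apply, b.repr_apply_apply, rotBasis,
    HilbertBasis.coe_mkOfOrthogonalEqBot, inner_smul_left, conj_phase] at h
  rw [← h, ← mul_assoc, mul_comm (phase _ _), phase_mul_phase_neg, one_mul]

theorem rot_neg_rot (t : ℝ) (x : K) : rot b θ (-t) (rot b θ t x) = x := by
  apply ext_inner_hilbertBasis b
  intro n
  rw [inner_rot, inner_rot, ← mul_assoc, phase_mul_phase_neg, one_mul]

theorem rot_rot_neg (t : ℝ) (x : K) : rot b θ t (rot b θ (-t) x) = x := by
  simpa using rot_neg_rot b θ (-t) x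

theorem rot_zero (x : K) : rot b θ 0 x = x := by
  apply ext_inner_hilbertBasis b
  intro n
  simp [inner_rot, phase]

theorem continuous_phase (r : ℝ) : Continuous (phase r) := by
  unfold phase
  fun_prop

/-- The vectors with continuous orbit form a subspace. It contains the basis vectors, and it is
closed because each `rot b θ t` is an isometry, so that approximating a vector approximates its
orbit uniformly in `t`. -/
theorem continuous_rot (x : K) : Continuous fun t => rot b θ t x := by
  let S : Submodule ℂ K :=
    { carrier := {x | Continuous fun t => rot b θ t x}
      zero_mem' := by simpa using continuous_const
      add_mem' := fun {x y} hx hy => (Continuous.add hx hy).congr fun t => (map_add _ _ _).symm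
      smul_mem' := fun c x hx => (Continuous.const_smul hx c).congr fun t => (map_smul _ _ _).symm }
  have hb : ∀ n, b n ∈ S := fun n => by
    have h : ∀ t, rot b θ t (b n) = phase (θ n) t • b n := fun t => by
      classical
      apply ext_inner_hilbertBasis b
      intro m
      rw [inner_rot, inner_smul_right, orthonormal_iff_ite.1 b.orthonormal]
      split_ifs with h
      · rw [h]
      · simp
    change Continuous fun t => rot b θ t (b n)
    simp_rw [h]
    exact (continuous_phase _).smul continuous_const
  have hcl : S.topologicalClosure ≤ S := by
    intro x hx
    change Continuous fun t => rot b θ t x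
    refine continuous_of_uniform_approx_of_continuous fun u hu => ?_
    obtain ⟨ε, hε, hu⟩ := Metric.mem_uniformity_dist.1 hu
    obtain ⟨y, hy, hxy⟩ := Metric.mem_closure_iff.1 (show x ∈ closure (S : Set K) from hx) ε hε
    exact ⟨fun t => rot b θ t y, hy, fun t => hu (by rwa [(rot b θ t).dist_map])⟩
  have htop : (⊤ : Submodule ℂ K) ≤ S := by
    rw [← b.dense_span]
    exact (Submodule.topologicalClosure_mono
      (Submodule.span_le.2 (range_subset_iff.2 hb))).trans hcl
  exact htop (Submodule.mem_top (x := x))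

/-- Strong continuity of a family of isometries is already joint continuity, by the triangle
inequality. -/
theorem continuous_rot_uncurry : Continuous fun q : ℝ × K => rot b θ q.1 q.2 := by
  rw [continuous_iff_continuousAt]
  rintro ⟨t, x⟩
  rw [ContinuousAt, tendsto_iff_dist_tendsto_zero]
  have h1 : Filter.Tendsto (fun q : ℝ × K => dist q.2 x + dist (rot b θ q.1 x) (rot b θ t x))
      (nhds (t, x)) (nhds 0) := by
    have : Continuous fun q : ℝ × K => dist q.2 x + dist (rot b θ q.1 x) (rot b θ t x) := by
      have := (continuous_rot b θ x).comp (continuous_fst (X := ℝ) (Y := K))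
      exact (continuous_snd.dist continuous_const).add (this.dist continuous_const)
    simpa using this.tendsto (t, x)
  refine squeeze_zero (fun _ => dist_nonneg) (fun q => ?_) h1
  refine (dist_triangle _ (rot b θ q.1 x) _).trans ?_
  rw [(rot b θ q.1).dist_map]

theorem continuousOn_rot_apply {S : Set ℝ} {r : ℝ → ℝ} {u : ℝ → K} (hr : ContinuousOn r S)
    (hu : ContinuousOn u S) : ContinuousOn (fun t => rot b θ (r t) (u t)) S :=
  Continuous.comp_continuousOn (f := fun t => (r t, u t)) (continuous_rot_uncurry b θ)
    (hr.prodMk hu)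

/-- The function `v(t) = e^{μt} T(-t) u(t)` satisfies `v' = C(t) v` with this operator `C(t)`. -/
noncomputable def interaction (B : K →L[ℂ] K) (s : ℝ) (x : K) : K :=
  -rot b θ (-s) (B (rot b θ s x))

theorem continuous_interaction (B : K →L[ℂ] K) :
    Continuous fun q : ℝ × K => interaction b θ B q.1 q.2 := by
  have h1 : Continuous fun q : ℝ × K => B (rot b θ q.1 q.2) :=
    B.continuous.comp (continuous_rot_uncurry b θ)
  exact (Continuous.comp (f := fun q : ℝ × K => (-q.1, B (rot b θ q.1 q.2)))
    (continuous_rot_uncurry b θ) (continuous_fst.neg.prodMk h1)).neg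

theorem continuousOn_interaction_apply (B : K →L[ℂ] K) {S : Set ℝ} {u : ℝ → K}
    (hu : ContinuousOn u S) : ContinuousOn (fun t => interaction b θ B t (u t)) S :=
  Continuous.comp_continuousOn (f := fun t => (t, u t)) (continuous_interaction b θ B)
    (continuousOn_id.prodMk hu)

theorem norm_interaction_sub_le (B : K →L[ℂ] K) (s : ℝ) (x y : K) :
    ‖interaction b θ B s x - interaction b θ B s y‖ ≤ ‖B‖ * ‖x - y‖ := by
  unfold interaction
  rw [neg_sub_neg, ← map_sub, ← map_sub, ← map_sub, LinearIsometryEquiv.norm_map, norm_sub_rev x y]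
  refine (B.le_opNorm _).trans ?_
  rw [LinearIsometryEquiv.norm_map]

theorem interaction_zero (B : K →L[ℂ] K) (s : ℝ) : interaction b θ B s 0 = 0 := by
  simp [interaction]

theorem norm_interaction_le (B : K →L[ℂ] K) (s : ℝ) (x : K) :
    ‖interaction b θ B s x‖ ≤ ‖B‖ * ‖x‖ := by
  simpa [interaction_zero] using norm_interaction_sub_le b θ B s x 0

theorem inner_interaction (B : K →L[ℂ] K) (s : ℝ) (x : K) (n : ι) :
    ⟪b n, interaction b θ B s x⟫ = -(phase (θ n) (-s) * ⟪b n, B (rot b θ s x)⟫) := by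
  rw [interaction, inner_neg_right, inner_rot]

end Rotation

/-! ### The perturbed diagonal equation, coefficient by coefficient. -/

section Modal

variable {ι K : Type*} [NormedAddCommGroup K] [InnerProductSpace ℂ K]

local notation "⟪" x ", " y "⟫" => inner ℂ x y

/-- The eigenvalue `μ + iθ`. -/
noncomputable def kap (μ θ : ℝ) : ℂ := μ + θ * Complex.I

/-- `u` solves `u' = -(A₀ + B) u`, `u(0) = u₀`, tested against the basis `b`, where
`A₀ b_n = (μ + iθ_n) b_n`. -/
structure IsModalSol (b : HilbertBasis ι ℂ K) (θ : ι → ℝ) (μ : ℝ) (B : K →L[ℂ] K) (u₀ : K)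
    (u : ℝ → K) : Prop where
  continuousOn : ContinuousOn u (Ici 0)
  modal : ∀ n t, 0 ≤ t → ⟪b n, u t⟫ =
    ⟪b n, u₀⟫ + ∫ s in (0 : ℝ)..t, -(kap μ (θ n) * ⟪b n, u s⟫ + ⟪b n, B (u s)⟫)

/-- `g = (A₀ + B) f` in terms of the coefficients with respect to the basis `b`. -/
def InGraph (b : HilbertBasis ι ℂ K) (θ : ι → ℝ) (μ : ℝ) (B : K →L[ℂ] K) (f g : K) : Prop :=
  ∀ n, ⟪b n, g⟫ = kap μ (θ n) * ⟪b n, f⟫ + ⟪b n, B f⟫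

variable {b : HilbertBasis ι ℂ K} {θ : ι → ℝ} {μ : ℝ} {B : K →L[ℂ] K}

theorem exp_mul_phase (μ θ t : ℝ) :
    (Real.exp (μ * t) : ℂ) * phase θ (-t) = Complex.exp (kap μ θ * t) := by
  rw [phase, Complex.ofReal_exp, ← Complex.exp_add]
  congr 1
  push_cast [kap]
  ring

theorem hasDerivAt_exp_kap (c : ℂ) (t : ℝ) :
    HasDerivAt (fun t : ℝ => Complex.exp (c * t)) (Complex.exp (c * t) * c) t := by
  have h : HasDerivAt (fun t : ℝ => c * (t : ℂ)) c t := by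
    simpa using (HasDerivAt.ofReal_comp (hasDerivAt_id t)).const_mul c
  exact h.cexp

theorem inner_intervalIntegral_right [CompleteSpace K] (x : K) {F : ℝ → K}
    (hF : ContinuousOn F (Ici 0)) {t : ℝ} (ht : 0 ≤ t) :
    ⟪x, ∫ s in (0 : ℝ)..t, F s⟫ = ∫ s in (0 : ℝ)..t, ⟪x, F s⟫ := by
  have h : IntervalIntegrable F volume 0 t :=
    (hF.mono (by rw [uIcc_of_le ht]; exact Icc_subset_Ici_self)).intervalIntegrable
  exact ((innerSL ℂ x).intervalIntegral_comp_comm h).symm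

theorem IsModalSol.initial {u₀ : K} {u : ℝ → K} (h : IsModalSol b θ μ B u₀ u) : u 0 = u₀ :=
  ext_inner_hilbertBasis b fun n => by simpa using h.modal n 0 le_rfl

theorem IsModalSol.hasDerivWithinAt {u₀ : K} {u : ℝ → K} (h : IsModalSol b θ μ B u₀ u) (n : ι)
    {t : ℝ} (ht : 0 ≤ t) :
    HasDerivWithinAt (fun t => ⟪b n, u t⟫) (-(kap μ (θ n) * ⟪b n, u t⟫ + ⟪b n, B (u t)⟫))
      (Ici 0) t := by
  have hc := h.continuousOn
  have hB : ContinuousOn (fun s => B (u s)) (Ici 0) := B.continuous.comp_continuousOn hc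
  refine hasDerivWithinAt_volterra ?_ (h.modal n) ht
  fun_prop

theorem IsModalSol.sub {x y : K} {u v : ℝ → K} (hu : IsModalSol b θ μ B x u)
    (hv : IsModalSol b θ μ B y v) : IsModalSol b θ μ B (x - y) fun t => u t - v t := by
  have hcu := hu.continuousOn
  have hcv := hv.continuousOn
  have hBu : ContinuousOn (fun s => B (u s)) (Ici 0) := B.continuous.comp_continuousOn hcu
  have hBv : ContinuousOn (fun s => B (v s)) (Ici 0) := B.continuous.comp_continuousOn hcv
  refine ⟨hcu.sub hcv, fun n t ht => ?_⟩
  have hs : uIcc 0 t ⊆ Ici 0 := by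
    rw [uIcc_of_le ht]
    exact Icc_subset_Ici_self
  rw [inner_sub_right, hu.modal n t ht, hv.modal n t ht, inner_sub_right, add_sub_add_comm,
    ← intervalIntegral.integral_sub]
  · congr 1
    refine intervalIntegral.integral_congr fun s _ => ?_
    simp only [inner_sub_right, map_sub]
    ring
  · exact ContinuousOn.intervalIntegrable (ContinuousOn.mono (by fun_prop) hs)
  · exact ContinuousOn.intervalIntegrable (ContinuousOn.mono (by fun_prop) hs)

variable [CompleteSpace K]

theorem continuousOn_exp_smul_rot (μ : ℝ) {u : ℝ → K} (hu : ContinuousOn u (Ici 0)) :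
    ContinuousOn (fun t : ℝ => Real.exp (μ * t) • rot b θ (-t) (u t)) (Ici 0) := by
  have h1 : ContinuousOn (fun t : ℝ => rot b θ (-t) (u t)) (Ici 0) :=
    continuousOn_rot_apply b θ continuousOn_id.neg hu
  have h2 : ContinuousOn (fun t : ℝ => Real.exp (μ * t)) (Ici 0) := by fun_prop
  exact h2.smul h1

/-- The interaction picture. The integrating factors `e^{κ_n t}` of the single coefficients are
together the operator `e^{μt} T(-t)`, with `T` the unitary group. Removing them eliminates the
unbounded diagonal part and leaves an integral equation with a bounded right-hand side. -/
theorem isModalSol_iff {u₀ : K} {u : ℝ → K} (hu : ContinuousOn u (Ici 0)) :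
    IsModalSol b θ μ B u₀ u ↔ ∀ t, 0 ≤ t → Real.exp (μ * t) • rot b θ (-t) (u t)
      = u₀ + ∫ s in (0 : ℝ)..t,
        interaction b θ B s (Real.exp (μ * s) • rot b θ (-s) (u s)) := by
  set v : ℝ → K := fun t => Real.exp (μ * t) • rot b θ (-t) (u t) with hv
  have hvc : ContinuousOn v (Ici 0) := continuousOn_exp_smul_rot μ hu
  have hCc : ContinuousOn (fun s => interaction b θ B s (v s)) (Ici 0) :=
    continuousOn_interaction_apply b θ B hvc
  have hB : ContinuousOn (fun s => B (u s)) (Ici 0) := B.continuous.comp_continuousOn hu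
  have hvn : ∀ n t, ⟪b n, v t⟫ = Complex.exp (kap μ (θ n) * t) * ⟪b n, u t⟫ := fun n t => by
    rw [hv, ← exp_mul_phase]
    simp only
    rw [← Complex.coe_smul, inner_smul_right, inner_rot, mul_assoc]
  have hun : ∀ n t, ⟪b n, u t⟫ = Complex.exp (-kap μ (θ n) * t) * ⟪b n, v t⟫ := fun n t => by
    rw [hvn, ← mul_assoc, ← Complex.exp_add]
    simp
  have hCn : ∀ n s, ⟪b n, interaction b θ B s (v s)⟫
      = -(Complex.exp (kap μ (θ n) * s) * ⟪b n, B (u s)⟫) := fun n s => by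
    rw [inner_interaction, ← exp_mul_phase, hv]
    simp only
    rw [← Complex.coe_smul, map_smul, map_smul, inner_smul_right, rot_rot_neg]
    ring
  constructor
  · intro h t ht
    apply ext_inner_hilbertBasis b
    intro n
    rw [inner_add_right, inner_intervalIntegral_right _ hCc ht]
    have hd : ∀ t, 0 ≤ t → HasDerivWithinAt (fun t => ⟪b n, v t⟫)
        ⟪b n, interaction b θ B t (v t)⟫ (Ici 0) t := fun t ht => by
      simp_rw [hvn, hCn]
      convert! ((hasDerivAt_exp_kap (kap μ (θ n)) t).hasDerivWithinAt.mul
        (h.hasDerivWithinAt n ht)) using 1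
      ring
    have h0 : v 0 = u₀ := by simp [hv, rot_zero, h.initial]
    have := eq_add_integral_of_hasDerivWithinAt (by fun_prop) hd ht
    rwa [h0] at this
  · intro h
    refine ⟨hu, fun n t ht => ?_⟩
    have hd : ∀ t, 0 ≤ t → HasDerivWithinAt (fun t => ⟪b n, u t⟫)
        (-(kap μ (θ n) * ⟪b n, u t⟫ + ⟪b n, B (u t)⟫)) (Ici 0) t := fun t ht => by
      have h1 : HasDerivWithinAt (fun t => ⟪b n, v t⟫) ⟪b n, interaction b θ B t (v t)⟫
          (Ici 0) t := by
        refine hasDerivWithinAt_volterra (F := fun s => ⟪b n, interaction b θ B s (v s)⟫)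
          (x₀ := ⟪b n, u₀⟫) (by fun_prop) (fun t ht => ?_) ht
        rw [← inner_intervalIntegral_right _ hCc ht, ← inner_add_right, ← h t ht]
      have h2 := (hasDerivAt_exp_kap (-kap μ (θ n)) t).hasDerivWithinAt.mul h1
      have h3 : (fun t => ⟪b n, u t⟫) =
          ((fun t : ℝ => Complex.exp (-kap μ (θ n) * t)) * fun t => ⟪b n, v t⟫) := by
        funext s
        exact hun n s
      rw [h3]
      convert! h2 using 1
      rw [hCn, hvn]
      have h4 : Complex.exp (-kap μ (θ n) * t) * Complex.exp (kap μ (θ n) * t) = 1 := by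
        rw [← Complex.exp_add]; simp
      linear_combination (kap μ (θ n) * ⟪b n, u t⟫ + ⟪b n, B (u t)⟫) * h4
    have h0 : u 0 = u₀ := by simpa [rot_zero] using h 0 le_rfl
    have := eq_add_integral_of_hasDerivWithinAt (by fun_prop) hd ht
    rwa [h0] at this

theorem norm_exp_smul_rot (μ t : ℝ) (x : K) :
    ‖Real.exp (μ * t) • rot b θ (-t) x‖ = Real.exp (μ * t) * ‖x‖ := by
  rw [norm_smul, Real.norm_of_nonneg (Real.exp_pos _).le, LinearIsometryEquiv.norm_map]

/-- The source of the decay rate: conjugation by unitaries does not enlarge `‖B‖`, so Gronwall's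
inequality bounds `e^{μt}‖u(t)‖` by `e^{‖B‖t}‖u₀‖`. -/
theorem IsModalSol.norm_le {u₀ : K} {u : ℝ → K} (h : IsModalSol b θ μ B u₀ u) {t : ℝ}
    (ht : 0 ≤ t) : ‖u t‖ ≤ Real.exp (-(μ - ‖B‖) * t) * ‖u₀‖ := by
  have h1 := (isModalSol_iff h.continuousOn).1 h
  have hvc := continuousOn_exp_smul_rot (b := b) (θ := θ) μ h.continuousOn
  have h2 := norm_le_exp_of_volterra
    (continuousOn_interaction_apply b θ B hvc) h1
    (fun s _ => norm_interaction_le b θ B s _) ht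
  rw [norm_exp_smul_rot] at h2
  have h3 : ‖u t‖ = Real.exp (-(μ * t)) * (Real.exp (μ * t) * ‖u t‖) := by
    rw [← mul_assoc, ← Real.exp_add]; simp
  rw [h3]
  refine (mul_le_mul_of_nonneg_left h2 (Real.exp_pos _).le).trans_eq ?_
  rw [← mul_assoc, ← Real.exp_add]
  congr 2
  ring

theorem IsModalSol.unique {x : K} {u v : ℝ → K} (hu : IsModalSol b θ μ B x u)
    (hv : IsModalSol b θ μ B x v) {t : ℝ} (ht : 0 ≤ t) : u t = v t := by
  have h := (hu.sub hv).norm_le ht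
  rw [sub_self, norm_zero, mul_zero] at h
  exact sub_eq_zero.1 (norm_le_zero_iff.1 h)

variable (b θ μ B) in
theorem exists_isModalSol (x : K) : ∃ u, IsModalSol b θ μ B x u := by
  obtain ⟨v, hvc, hv⟩ := exists_volterra (M := ‖B‖ + 1) (by positivity)
    (continuous_interaction b θ B) (interaction_zero b θ B)
    (fun s x y => (norm_interaction_sub_le b θ B s x y).trans
      (mul_le_mul_of_nonneg_right (by linarith) (norm_nonneg _))) x
  have h : ∀ t, Real.exp (μ * t) • rot b θ (-t) (Real.exp (-(μ * t)) • rot b θ t (v t)) = v t := by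
    intro t
    rw [← Complex.coe_smul (Real.exp (-(μ * t))), map_smul, rot_neg_rot, Complex.coe_smul, smul_smul,
      ← Real.exp_add]
    simp
  refine ⟨fun t => Real.exp (-(μ * t)) • rot b θ t (v t), (isModalSol_iff ?_).2 ?_⟩
  · have h1 : Continuous fun t : ℝ => rot b θ t (v t) :=
      continuousOn_univ.1 (continuousOn_rot_apply b θ continuousOn_id hvc.continuousOn)
    exact Continuous.continuousOn (by fun_prop)
  · simp_rw [h]
    exact hv

/-- If `y = (A₀ + B)x` and `w` is the solution issued from `y`, then `x - ∫ w` is the candidate for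
the solution issued from `x`. The time-integrated equation of `w` says exactly that `A₀ + B` maps
this candidate to `w(t)`. Together with `IsModalSol.integral` and uniqueness, this makes the flow
commute with `A₀ + B`. -/
theorem IsModalSol.graph {x y : K} {w : ℝ → K} (hw : IsModalSol b θ μ B y w)
    (hxy : InGraph b θ μ B x y) {t : ℝ} (ht : 0 ≤ t) :
    InGraph b θ μ B (x + ∫ s in (0 : ℝ)..t, -w s) (w t) := by
  intro n
  have hc := hw.continuousOn
  have hcn : ContinuousOn (fun s => -w s) (Ici 0) := hc.neg
  have hB : ContinuousOn (fun s => B (w s)) (Ici 0) := B.continuous.comp_continuousOn hc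
  have hs : uIcc 0 t ⊆ Ici 0 := by
    rw [uIcc_of_le ht]
    exact Icc_subset_Ici_self
  have hBn : ContinuousOn (fun s => -B (w s)) (Ici 0) := hB.neg
  have h1 : B (∫ s in (0 : ℝ)..t, -w s) = ∫ s in (0 : ℝ)..t, -B (w s) := by
    rw [← B.intervalIntegral_comp_comm (hcn.mono hs).intervalIntegrable]
    simp
  rw [hw.modal n t ht, hxy n, map_add, h1, inner_add_right, inner_add_right,
    inner_intervalIntegral_right _ hcn ht, inner_intervalIntegral_right _ hBn ht]
  simp only [inner_neg_right, neg_add]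
  rw [intervalIntegral.integral_add]
  · simp only [intervalIntegral.integral_neg, intervalIntegral.integral_const_mul]
    ring
  · exact ContinuousOn.intervalIntegrable (ContinuousOn.mono (by fun_prop) hs)
  · exact ContinuousOn.intervalIntegrable (ContinuousOn.mono (by fun_prop) hs)

theorem IsModalSol.integral {x y : K} {w : ℝ → K} (hw : IsModalSol b θ μ B y w)
    (hxy : InGraph b θ μ B x y) :
    IsModalSol b θ μ B x fun t => x + ∫ s in (0 : ℝ)..t, -w s := by
  have hc := hw.continuousOn
  have hcn : ContinuousOn (fun s => -w s) (Ici 0) := hc.neg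
  have hd : ∀ t, 0 ≤ t → HasDerivWithinAt (fun t => x + ∫ s in (0 : ℝ)..t, -w s) (-w t)
      (Ici 0) t := fun t ht => hasDerivWithinAt_volterra hcn (fun _ _ => rfl) ht
  refine ⟨fun t ht => (hd t ht).continuousWithinAt, fun n t ht => ?_⟩
  rw [inner_add_right, inner_intervalIntegral_right _ hcn ht]
  congr 1
  refine intervalIntegral.integral_congr fun s hs => ?_
  rw [uIcc_of_le ht] at hs
  simp only [inner_neg_right]
  rw [hw.graph hxy hs.1 n]

/-- A solution with modal data satisfies the weak formulation for every test vector in the domain of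
the adjoint. -/
theorem IsModalSol.inner_eq {x : K} {u : ℝ → K} (hu : IsModalSol b θ μ B x u) {η ξ : K}
    (h : ∀ n, ⟪b n, ξ⟫ = -(starRingEnd ℂ) (kap μ (θ n)) * ⟪b n, η⟫) {t : ℝ} (ht : 0 ≤ t) :
    ⟪η, u t⟫ = ⟪η, x⟫ + ∫ s in (0 : ℝ)..t, (⟪ξ, u s⟫ - ⟪η, B (u s)⟫) := by
  have hc := hu.continuousOn
  have hB : ContinuousOn (fun s => B (u s)) (Ici 0) := B.continuous.comp_continuousOn hc
  have hs : uIcc 0 t ⊆ Ici 0 := by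
    rw [uIcc_of_le ht]
    exact Icc_subset_Ici_self
  -- The vector `u(t)` need not lie in the domain of `A₀`, but `∫ u` does: by the integrated
  -- equation, the numbers `κ_n ⟪b n, ∫ u⟫` are up to sign the coefficients of a vector of `K`.
  -- Parseval's identity can then move `κ_n` onto `η` term by term, without exchanging a series with
  -- the time integral.
  have hp : ∀ n, ⟪b n, u t - x + ∫ s in (0 : ℝ)..t, B (u s)⟫
      = -(kap μ (θ n) * ⟪b n, ∫ s in (0 : ℝ)..t, u s⟫) := fun n => by
    rw [inner_add_right, inner_sub_right, hu.modal n t ht, inner_intervalIntegral_right _ hc ht,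
      inner_intervalIntegral_right _ hB ht, ← intervalIntegral.integral_const_mul,
      intervalIntegral.integral_neg, intervalIntegral.integral_add]
    · ring
    · exact ContinuousOn.intervalIntegrable (ContinuousOn.mono (by fun_prop) hs)
    · exact ContinuousOn.intervalIntegrable (ContinuousOn.mono (by fun_prop) hs)
  have key : ⟪η, u t - x + ∫ s in (0 : ℝ)..t, B (u s)⟫ = ⟪ξ, ∫ s in (0 : ℝ)..t, u s⟫ := by
    rw [← b.tsum_inner_mul_inner, ← b.tsum_inner_mul_inner]
    congr 1
    funext n
    rw [hp, ← inner_conj_symm ξ, h, map_mul, map_neg, Complex.conj_conj, inner_conj_symm]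
    ring
  rw [inner_add_right, inner_sub_right, inner_intervalIntegral_right _ hc ht,
    inner_intervalIntegral_right _ hB ht] at key
  rw [intervalIntegral.integral_sub]
  · linear_combination key
  · exact ContinuousOn.intervalIntegrable (ContinuousOn.mono (by fun_prop) hs)
  · exact ContinuousOn.intervalIntegrable (ContinuousOn.mono (by fun_prop) hs)

variable (b θ μ B) in
/-- The solution operator of `u' = -(A₀ + B) u`. -/
noncomputable def evol (t : ℝ) (x : K) : K := (exists_isModalSol b θ μ B x).choose t

variable (b θ μ B) in
theorem evol_spec (x : K) : IsModalSol b θ μ B x fun t => evol b θ μ B t x :=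
  (exists_isModalSol b θ μ B x).choose_spec

theorem evol_graph {x y : K} (hxy : InGraph b θ μ B x y) {t : ℝ} (ht : 0 ≤ t) :
    InGraph b θ μ B (evol b θ μ B t x) (evol b θ μ B t y) ∧
      HasDerivWithinAt (fun s => evol b θ μ B s x) (-evol b θ μ B t y) (Ici 0) t := by
  have hw := evol_spec b θ μ B y
  have h : ∀ t, 0 ≤ t → evol b θ μ B t x = x + ∫ s in (0 : ℝ)..t, -evol b θ μ B s y :=
    fun t ht => (evol_spec b θ μ B x).unique (hw.integral hxy) ht
  refine ⟨?_, hasDerivWithinAt_volterra hw.continuousOn.neg h ht⟩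
  rw [h t ht]
  exact hw.graph hxy ht

end Modal

/-! ### Absolutely continuous functions and integration by parts -/

section IntegrationByParts

/-- Real and imaginary parts are treated separately, as real primitives multiplied by the constants
`1` and `i`. -/
theorem absolutelyContinuousOnInterval_integral_complex {d : ℝ → ℂ} {a b : ℝ}
    (hd : IntervalIntegrable d volume a b) :
    AbsolutelyContinuousOnInterval (fun x => ∫ s in a..x, d s) a b := by
  have hre : IntervalIntegrable (fun s => (d s).re) volume a b :=
    ⟨hd.1.re, hd.2.re⟩
  have him : IntervalIntegrable (fun s => (d s).im) volume a b :=
    ⟨hd.1.im, hd.2.im⟩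
  have h1 : ∀ c : ℂ, AbsolutelyContinuousOnInterval (fun _ : ℝ => c) a b := fun c =>
    contDiff_const.contDiffOn.absolutelyContinuousOnInterval
  have h := ((hre.absolutelyContinuousOnInterval_intervalIntegral left_mem_uIcc).smul (h1 1)).add
    ((him.absolutelyContinuousOnInterval_intervalIntegral left_mem_uIcc).smul (h1 Complex.I))
  refine (absolutelyContinuousOnInterval_iff _ a b).2 fun ε hε => ?_
  obtain ⟨r, hr, H⟩ := (absolutelyContinuousOnInterval_iff _ a b).1 h ε hε
  refine ⟨r, hr, fun I hI hlt => ?_⟩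
  have key : ∀ x ∈ uIcc a b, ∫ s in a..x, d s =
      (((fun x => ∫ s in a..x, (d s).re) • fun _ : ℝ => (1 : ℂ)) +
        ((fun x => ∫ s in a..x, (d s).im) • fun _ : ℝ => Complex.I)) x := fun x hx => by
    have hdx : IntervalIntegrable d volume a x :=
      hd.mono_set (uIcc_subset_uIcc left_mem_uIcc hx)
    have e1 := Complex.reCLM.intervalIntegral_comp_comm hdx
    have e2 := Complex.imCLM.intervalIntegral_comp_comm hdx
    simp only [Complex.reCLM_apply, Complex.imCLM_apply] at e1 e2
    simp only [Pi.add_apply, Pi.smul_apply', Complex.real_smul, mul_one, e1, e2]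
    exact (Complex.re_add_im _).symm
  refine (Finset.sum_congr rfl fun i hi => ?_).trans_lt (H I hI hlt)
  have hm := hI.1 i hi
  simp only [key _ hm.1, key _ hm.2]

/-- Integration by parts when `q` is only a primitive of an integrable function: the primitive of
`p'q + pd` minus `pq` is absolutely continuous with derivative zero almost everywhere, hence
constant. -/
theorem integral_deriv_mul_add_mul_deriv {p p' q d : ℝ → ℂ} {L : ℝ} (hL : 0 ≤ L)
    (hp : ∀ x, HasDerivAt p (p' x) x) (hp' : Continuous p')
    (hd : IntervalIntegrable d volume 0 L)
    (hq : ∀ x ∈ Icc 0 L, q x = q 0 + ∫ s in (0 : ℝ)..x, d s) :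
    ∫ x in (0 : ℝ)..L, (p' x * q x + p x * d x) = p L * q L - p 0 * q 0 := by
  set Q : ℝ → ℂ := fun x => q 0 + ∫ s in (0 : ℝ)..x, d s with hQ
  have hpc : Continuous p := continuous_iff_continuousAt.2 fun x => (hp x).continuousAt
  have hpd : deriv p = p' := funext fun x => (hp x).deriv
  have hp1 : ContDiff ℝ 1 p := contDiff_one_iff_deriv.2
    ⟨fun x => (hp x).differentiableAt, by rwa [hpd]⟩
  have hconst : ∀ c : ℂ, AbsolutelyContinuousOnInterval (fun _ : ℝ => c) 0 L := fun c =>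
    contDiff_const.contDiffOn.absolutelyContinuousOnInterval
  have hQac : AbsolutelyContinuousOnInterval Q 0 L :=
    (hconst (q 0)).add (absolutelyContinuousOnInterval_integral_complex hd)
  have hint : IntervalIntegrable (fun x => p' x * Q x + p x * d x) volume 0 L := by
    refine IntervalIntegrable.add ?_ (hd.continuousOn_mul hpc.continuousOn)
    exact (hp'.continuousOn.mul hQac.continuousOn).intervalIntegrable
  have hF : AbsolutelyContinuousOnInterval
      ((fun x => ∫ s in (0 : ℝ)..x, (p' s * Q s + p s * d s)) - p • Q) 0 L :=
    (absolutelyContinuousOnInterval_integral_complex hint).sub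
      (hp1.contDiffOn.absolutelyContinuousOnInterval.smul hQac)
  obtain ⟨c, hc⟩ := hF.const_of_ae_hasDerivAt_zero (by
    filter_upwards [hd.ae_hasDerivAt_integral, hint.ae_hasDerivAt_integral] with x h1 h2 hx
    have e1 : HasDerivAt Q (d x) x := (h1 hx 0 left_mem_uIcc).const_add _
    convert! (h2 hx 0 left_mem_uIcc).sub ((hp x).mul e1) using 1
    ring)
  have h0 := hc 0 left_mem_uIcc
  have h1 := hc L right_mem_uIcc
  simp only [Pi.sub_apply, smul_eq_mul, Pi.mul_apply, intervalIntegral.integral_same] at h0 h1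
  have hQ0 : Q 0 = q 0 := by simp [hQ]
  have hcongr : ∫ x in (0 : ℝ)..L, (p' x * q x + p x * d x)
      = ∫ x in (0 : ℝ)..L, (p' x * Q x + p x * d x) := by
    refine intervalIntegral.integral_congr fun x hx => ?_
    rw [uIcc_of_le hL] at hx
    simp only [hq x hx, hQ]
  rw [hcongr, hq L ⟨hL, le_rfl⟩]
  rw [← h0, hQ0] at h1
  linear_combination h1

end IntegrationByParts

/-! ### Multiplication operators and weak derivatives on `L²((0,L); ℂ²)` -/

section Operators

variable {L : ℝ}

local notation "E2" => EuclideanSpace ℂ (Fin 2)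

theorem L2.integrable (f : L2 L) : Integrable (fun x => f x) (volume.restrict (Ioo (0 : ℝ) L)) :=
  (Lp.memLp f).integrable (by norm_num)

theorem integrable_continuousOn_smul_L2 {φ : ℝ → ℝ} (hφ : ContinuousOn φ (Icc 0 L)) (f : L2 L) :
    Integrable (fun x => φ x • f x) (volume.restrict (Ioo (0 : ℝ) L)) := by
  obtain ⟨C, hC⟩ := isCompact_Icc.exists_bound_of_continuousOn hφ
  have hm : AEStronglyMeasurable φ (volume.restrict (Ioo (0 : ℝ) L)) :=
    (hφ.mono Ioo_subset_Icc_self).aestronglyMeasurable measurableSet_Ioo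
  exact (L2.integrable f).bdd_smul C hm
    ((ae_restrict_mem measurableSet_Ioo).mono fun x hx => hC x (Ioo_subset_Icc_self hx))

theorem integral_apply {F : ℝ → E2} (hF : Integrable F (volume.restrict (Ioo (0 : ℝ) L)))
    (i : Fin 2) : (∫ x in Ioo 0 L, F x) i = ∫ x in Ioo 0 L, F x i :=
  ((EuclideanSpace.proj (𝕜 := ℂ) i).integral_comp_comm hF).symm

theorem memLp_smul_L2 (m : C(ℝ, ℝ)) (f : L2 L) :
    MemLp (fun x => m x • f x) 2 (volume.restrict (Ioo (0 : ℝ) L)) := by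
  obtain ⟨C, hC⟩ := isCompact_Icc.exists_bound_of_continuousOn
    (m.continuous.continuousOn (s := Icc 0 L))
  refine (Lp.memLp f).of_le_mul (c := C)
    (m.continuous.aestronglyMeasurable.smul (Lp.aestronglyMeasurable f)) ?_
  filter_upwards [ae_restrict_mem measurableSet_Ioo] with x hx
  rw [norm_smul]
  exact mul_le_mul_of_nonneg_right (hC x (Ioo_subset_Icc_self hx)) (norm_nonneg _)

theorem norm_toLp_smul_le {m : C(ℝ, ℝ)} {c : ℝ} (hm : ∀ x ∈ Ioo 0 L, |m x| ≤ c) (f : L2 L) :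
    ‖(memLp_smul_L2 m f).toLp‖ ≤ c * ‖f‖ := by
  apply Lp.norm_le_mul_norm_of_ae_le_mul
  filter_upwards [(memLp_smul_L2 m f).coeFn_toLp, ae_restrict_mem measurableSet_Ioo] with x hx hx'
  rw [hx, norm_smul]
  exact mul_le_mul_of_nonneg_right (hm x hx') (norm_nonneg _)

variable (L) in
/-- Multiplication by a real continuous function on `L²((0,L); ℂ²)`. -/
noncomputable def smulOp (m : C(ℝ, ℝ)) : L2 L →L[ℂ] L2 L :=
  LinearMap.mkContinuousOfExistsBound
    { toFun := fun f => (memLp_smul_L2 m f).toLp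
      map_add' := fun f g => by
        rw [← MemLp.toLp_add]
        apply MemLp.toLp_congr
        filter_upwards [Lp.coeFn_add f g] with x hx
        rw [hx, Pi.add_apply, smul_add, Pi.add_apply]
      map_smul' := fun c f => by
        rw [RingHom.id_apply, ← MemLp.toLp_const_smul]
        apply MemLp.toLp_congr
        filter_upwards [Lp.coeFn_smul c f] with x hx
        rw [hx, Pi.smul_apply, smul_comm, Pi.smul_apply] }
    (by
      obtain ⟨C, hC⟩ := isCompact_Icc.exists_bound_of_continuousOn
        (m.continuous.continuousOn (s := Icc 0 L))
      exact ⟨C, norm_toLp_smul_le fun x hx => hC x (Ioo_subset_Icc_self hx)⟩)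

theorem coeFn_smulOp (m : C(ℝ, ℝ)) (f : L2 L) :
    smulOp L m f =ᵐ[volume.restrict (Ioo (0 : ℝ) L)] fun x => m x • f x :=
  (memLp_smul_L2 m f).coeFn_toLp

theorem norm_smulOp_le {m : C(ℝ, ℝ)} {c : ℝ} (hc : 0 ≤ c) (hm : ∀ x ∈ Ioo 0 L, |m x| ≤ c) :
    ‖smulOp L m‖ ≤ c :=
  ContinuousLinearMap.opNorm_le_bound _ hc (norm_toLp_smul_le hm)

variable (L) in
/-- The pointwise action of a constant matrix on `L²((0,L); ℂ²)`. -/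
noncomputable def constOp (A : E2 →L[ℂ] E2) : L2 L →L[ℂ] L2 L :=
  A.compLpL 2 (volume.restrict (Ioo (0 : ℝ) L))

theorem coeFn_constOp (A : E2 →L[ℂ] E2) (f : L2 L) :
    constOp L A f =ᵐ[volume.restrict (Ioo (0 : ℝ) L)] fun x => A (f x) :=
  A.coeFn_compLpL f

theorem memLp_of_continuousOn {u : ℝ → E2} (hu : ContinuousOn u (Icc 0 L)) :
    MemLp u 2 (volume.restrict (Ioo (0 : ℝ) L)) := by
  obtain ⟨C, hC⟩ := isCompact_Icc.exists_bound_of_continuousOn hu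
  refine MemLp.of_bound
    ((hu.mono Ioo_subset_Icc_self).aestronglyMeasurable measurableSet_Ioo) C ?_
  exact (ae_restrict_mem measurableSet_Ioo).mono fun x hx => hC x (Ioo_subset_Icc_self hx)

theorem ae_eq_zero_of_integral_test {F : ℝ → E2}
    (hF : Integrable F (volume.restrict (Ioo (0 : ℝ) L)))
    (h : ∀ φ : ℝ → ℝ, ContDiff ℝ ∞ φ → HasCompactSupport φ → tsupport φ ⊆ Ioo 0 L →
      ∫ x in Ioo 0 L, φ x • F x = 0) : F =ᵐ[volume.restrict (Ioo (0 : ℝ) L)] 0 := by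
  rw [Filter.EventuallyEq, ae_restrict_iff' measurableSet_Ioo]
  refine isOpen_Ioo.ae_eq_zero_of_integral_contDiff_smul_eq_zero
    (IntegrableOn.locallyIntegrableOn hF) fun φ h1 h2 h3 => ?_
  rw [← h φ h1 h2 h3, setIntegral_eq_integral_of_forall_compl_eq_zero]
  intro x hx
  rw [image_eq_zero_of_notMem_tsupport fun h => hx (h3 h), zero_smul]

theorem HasWeakDeriv.unique {f g g' : L2 L} (h : HasWeakDeriv f g) (h' : HasWeakDeriv f g') :
    g = g' := by
  have hi := (L2.integrable g).sub (L2.integrable g')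
  have := ae_eq_zero_of_integral_test hi fun φ h1 h2 h3 => by
    simp only [Pi.sub_apply, smul_sub]
    rw [integral_sub (integrable_smul_L2 h1.continuous h2 g)
      (integrable_smul_L2 h1.continuous h2 g'), sub_eq_zero, ← neg_inj, ← h φ h1 h2 h3,
      h' φ h1 h2 h3]
  apply Lp.ext
  filter_upwards [this] with x hx
  exact sub_eq_zero.1 hx

theorem HasWeakDeriv.constOp {f d : L2 L} (A : E2 →L[ℂ] E2) (h : HasWeakDeriv f d) :
    HasWeakDeriv (constOp L A f) (constOp L A d) := by
  intro φ hφ hc hs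
  have key : ∀ (ψ : ℝ → ℝ), Continuous ψ → HasCompactSupport ψ → ∀ a : L2 L,
      ∫ x in Ioo 0 L, ψ x • WaterTank.constOp L A a x = A (∫ x in Ioo 0 L, ψ x • a x) := by
    intro ψ h1 h2 a
    rw [← A.integral_comp_comm (integrable_smul_L2 h1 h2 a)]
    apply integral_congr_ae
    filter_upwards [coeFn_constOp A a] with x hx
    rw [hx, ← Complex.coe_smul, ← Complex.coe_smul, map_smul]
  rw [key _ (hφ.continuous_deriv (by simp)) hc.deriv, key _ hφ.continuous hc, h φ hφ hc hs, map_neg]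

theorem HasWeakDeriv.smulOp {f d : L2 L} {m m' : C(ℝ, ℝ)} (hm : ContDiff ℝ ∞ m)
    (hm' : ∀ x, deriv m x = m' x) (h : HasWeakDeriv f d) :
    HasWeakDeriv (smulOp L m f) (smulOp L m' f + smulOp L m d) := by
  intro φ hφ hc hs
  have hφm : ContDiff ℝ ∞ fun x => φ x * m x := hφ.mul hm
  have hcm : HasCompactSupport fun x => φ x * m x := hc.mul_right
  have hsm : tsupport (fun x => φ x * m x) ⊆ Ioo 0 L := (tsupport_mul_subset_left).trans hs
  have hφd : Continuous (deriv φ) := hφ.continuous_deriv (by simp)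
  have hder : ∀ x, deriv (fun x => φ x * m x) x = deriv φ x * m x + φ x * m' x := fun x => by
    rw [← hm', deriv_fun_mul (hφ.differentiable (by simp) x) (hm.differentiable (by simp) x)]
  have key : ∀ (ψ : ℝ → ℝ) (n : C(ℝ, ℝ)) (a : L2 L),
      ∫ x in Ioo 0 L, ψ x • WaterTank.smulOp L n a x = ∫ x in Ioo 0 L, (ψ x * n x) • a x := by
    intro ψ n a
    apply integral_congr_ae
    filter_upwards [coeFn_smulOp n a] with x hx
    rw [hx, smul_smul]
  have h1 := h _ hφm hcm hsm
  simp only [hder, add_smul] at h1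
  rw [integral_add] at h1
  · have h2 : ∫ x in Ioo 0 L, φ x • (WaterTank.smulOp L m' f + WaterTank.smulOp L m d : L2 L) x
        = (∫ x in Ioo 0 L, φ x • WaterTank.smulOp L m' f x)
          + ∫ x in Ioo 0 L, φ x • WaterTank.smulOp L m d x := by
      rw [← integral_add (integrable_smul_L2 hφ.continuous hc _)
        (integrable_smul_L2 hφ.continuous hc _)]
      apply integral_congr_ae
      filter_upwards [Lp.coeFn_add (WaterTank.smulOp L m' f) (WaterTank.smulOp L m d)] with x hx
      rw [hx, Pi.add_apply, smul_add]
    rw [h2, key, key, key, neg_add, ← h1]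
    abel
  · exact integrable_continuousOn_smul_L2 (hφd.mul m.continuous).continuousOn f
  · exact integrable_continuousOn_smul_L2 (hφ.continuous.mul m'.continuous).continuousOn f

theorem HasWeakDeriv.sub {f g f' g' : L2 L} (hf : HasWeakDeriv f f') (hg : HasWeakDeriv g g') :
    HasWeakDeriv (f - g) (f' - g') := by
  simpa [sub_eq_add_neg] using hf.add (hg.smul (-1))

end Operators

/-! ### Continuous representatives of functions with a weak derivative. -/

section Representatives

variable {L : ℝ}

local notation "E2" => EuclideanSpace ℂ (Fin 2)

/-- `u` is on `[0,L]` a primitive of `d`, componentwise. -/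
def IsPrimitive (L : ℝ) (u d : ℝ → E2) : Prop :=
  ∀ i, ∀ x ∈ Icc 0 L, u x i = u 0 i + ∫ s in (0 : ℝ)..x, d s i

theorem L2.intervalIntegrable_apply (hL : 0 ≤ L) (d : L2 L) (i : Fin 2) :
    IntervalIntegrable (fun x => d x i) volume 0 L := by
  rw [intervalIntegrable_iff_integrableOn_Ioo_of_le hL]
  exact (EuclideanSpace.proj (𝕜 := ℂ) i).integrable_comp (L2.integrable d)

theorem setIntegral_Ioo_eq (hL : 0 ≤ L) (F : ℝ → ℂ) :
    ∫ x in Ioo 0 L, F x = ∫ x in (0 : ℝ)..L, F x := by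
  rw [intervalIntegral.integral_of_le hL, integral_Ioc_eq_integral_Ioo]

theorem continuousOn_primitive (hL : 0 ≤ L) (d : L2 L) (i : Fin 2) :
    ContinuousOn (fun x => ∫ s in (0 : ℝ)..x, d s i) (Icc 0 L) := by
  rw [← uIcc_of_le hL]
  exact (absolutelyContinuousOnInterval_integral_complex
    (L2.intervalIntegrable_apply hL d i)).continuousOn

theorem IsPrimitive.continuousOn (hL : 0 ≤ L) {u : ℝ → E2} {d : L2 L} (h : IsPrimitive L u d) :
    ContinuousOn u (Icc 0 L) := by
  have h1 : ∀ i, ContinuousOn (fun x => u x i) (Icc 0 L) := fun i =>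
    (continuousOn_const.add (continuousOn_primitive hL d i)).congr fun x hx => h i x hx
  have h2 : ContinuousOn (fun x => WithLp.toLp 2 (fun i => u x i)) (Icc 0 L) :=
    (PiLp.continuous_toLp 2 _).comp_continuousOn (continuousOn_pi.2 h1)
  exact h2

/-- The function `c + ∫₀ˣ d`. -/
noncomputable def primitive (c : E2) (d : ℝ → E2) (x : ℝ) : E2 :=
  WithLp.toLp 2 fun i => c i + ∫ s in (0 : ℝ)..x, d s i

theorem isPrimitive_primitive (c : E2) (d : ℝ → E2) : IsPrimitive L (primitive c d) d := by
  intro i x _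
  simp [primitive]

theorem IsPrimitive.hasWeakDeriv (hL : 0 ≤ L) {u : ℝ → E2} {f d : L2 L} (h : IsPrimitive L u d)
    (hfu : f =ᵐ[volume.restrict (Ioo (0 : ℝ) L)] u) : HasWeakDeriv f d := by
  intro φ hφ hc hs
  have hφd : Continuous (deriv φ) := hφ.continuous_deriv (by simp)
  have h0 : ∀ x, x ∉ Ioo 0 L → φ x = 0 := fun x hx =>
    image_eq_zero_of_notMem_tsupport fun h' => hx (hs h')
  have hcongr : ∫ x in Ioo 0 L, deriv φ x • f x = ∫ x in Ioo 0 L, deriv φ x • u x := by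
    apply integral_congr_ae
    filter_upwards [hfu] with x hx
    rw [hx]
  have hi1 : Integrable (fun x => deriv φ x • u x) (volume.restrict (Ioo (0 : ℝ) L)) :=
    (integrable_continuousOn_smul_L2 hφd.continuousOn f).congr
      (by filter_upwards [hfu] with x hx; rw [hx])
  have hi2 := integrable_smul_L2 hφ.continuous hc d
  have hi3 : Integrable (fun x => deriv φ x • u x + φ x • d x)
    (volume.restrict (Ioo (0 : ℝ) L)) := hi1.add hi2
  rw [hcongr, ← add_eq_zero_iff_eq_neg, ← integral_add hi1 hi2]
  ext i
  rw [integral_apply hi3, setIntegral_Ioo_eq hL]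
  have := integral_deriv_mul_add_mul_deriv hL (p := fun x => (φ x : ℂ))
    (p' := fun x => ((deriv φ x : ℝ) : ℂ))
    (fun x => (hφ.differentiable (by simp) x).hasDerivAt.ofReal_comp) (by fun_prop)
    (L2.intervalIntegrable_apply hL d i) (h i)
  rw [h0 L (by simp), h0 0 (by simp)] at this
  simpa using this

/-- Subtracting `(∫ φ) φ₀` makes the total integral zero. The primitive therefore vanishes to the
right of both supports as well as to their left, and is itself a test function. -/
theorem exists_test_primitive {φ φ₀ : ℝ → ℝ} (hφ : ContDiff ℝ ∞ φ) (hc : HasCompactSupport φ)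
    (hs : tsupport φ ⊆ Ioo 0 L) (hφ₀ : ContDiff ℝ ∞ φ₀) (hc₀ : HasCompactSupport φ₀)
    (hs₀ : tsupport φ₀ ⊆ Ioo 0 L) (hne : (tsupport φ₀).Nonempty) (h1 : ∫ x, φ₀ x = 1) :
    ∃ ψ : ℝ → ℝ, ContDiff ℝ ∞ ψ ∧ HasCompactSupport ψ ∧ tsupport ψ ⊆ Ioo 0 L ∧
      ∀ x, deriv ψ x = φ x - (∫ y, φ y) * φ₀ x := by
  set h : ℝ → ℝ := fun x => φ x - (∫ y, φ y) * φ₀ x with hh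
  have hhs : ContDiff ℝ ∞ h := hφ.sub (contDiff_const.mul hφ₀)
  set ψ : ℝ → ℝ := fun x => ∫ s in (0 : ℝ)..x, h s with hψ
  have hd : ∀ x, HasDerivAt ψ (h x) x := fun x =>
    intervalIntegral.integral_hasDerivAt_right (hhs.continuous.intervalIntegrable _ _)
      (hhs.continuous.stronglyMeasurableAtFilter _ _) hhs.continuous.continuousAt
  have hder : deriv ψ = h := funext fun x => (hd x).deriv
  have hKc : IsCompact (tsupport φ ∪ tsupport φ₀) := hc.isCompact.union hc₀.isCompact
  have hKn : (tsupport φ ∪ tsupport φ₀).Nonempty := hne.mono subset_union_right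
  obtain ⟨a, ha, ha'⟩ := hKc.exists_isLeast hKn
  obtain ⟨b, hb, hb'⟩ := hKc.exists_isGreatest hKn
  have haI : a ∈ Ioo 0 L := (union_subset hs hs₀) ha
  have hbI : b ∈ Ioo 0 L := (union_subset hs hs₀) hb
  have hzero : ∀ x, x ∉ Icc a b → h x = 0 := fun x hx => by
    have e1 : x ∉ tsupport φ := fun hm => hx ⟨ha' (Or.inl hm), hb' (Or.inl hm)⟩
    have e2 : x ∉ tsupport φ₀ := fun hm => hx ⟨ha' (Or.inr hm), hb' (Or.inr hm)⟩
    simp [hh, image_eq_zero_of_notMem_tsupport e1, image_eq_zero_of_notMem_tsupport e2]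
  have hint : ∫ x, h x = 0 := by
    rw [hh, integral_sub (hφ.continuous.integrable_of_hasCompactSupport hc)
      ((hφ₀.continuous.integrable_of_hasCompactSupport hc₀).const_mul _),
      integral_const_mul, h1]
    ring
  have hsupp : Function.support ψ ⊆ Icc a b := by
    intro x hx
    by_contra hxn
    apply hx
    rcases lt_or_ge x a with hxa | hxa
    · refine (intervalIntegral.integral_congr (g := fun _ => (0 : ℝ)) fun s hs => ?_).trans (by simp)
      apply hzero
      rintro ⟨h3, -⟩
      have := (hs.2).trans_lt (max_lt haI.1 hxa)
      exact absurd h3 (not_le.2 this)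
    · have hxb : b < x := by
        by_contra hlt
        exact hxn ⟨hxa, not_lt.1 hlt⟩
      rw [hψ]
      simp only
      rw [intervalIntegral.integral_eq_integral_of_support_subset, hint]
      intro s hs
      have hm : s ∈ Icc a b := by
        by_contra hm
        exact hs (hzero s hm)
      exact ⟨haI.1.trans_le hm.1, hm.2.trans hxb.le⟩
  have hts : tsupport ψ ⊆ Icc a b := closure_minimal hsupp isClosed_Icc
  refine ⟨ψ, ?_, HasCompactSupport.of_support_subset_isCompact isCompact_Icc hsupp,
    hts.trans fun x hx => ⟨haI.1.trans_le hx.1, hx.2.trans_lt hbI.2⟩, fun x => by rw [hder]⟩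
  exact contDiff_infty_iff_deriv.2 ⟨fun x => (hd x).differentiableAt, by rwa [hder]⟩

/-- The lemma of du Bois-Reymond. -/
theorem HasWeakDeriv.exists_const (hL : 0 < L) {f : L2 L} (h : HasWeakDeriv f 0) :
    ∃ c : E2, f =ᵐ[volume.restrict (Ioo (0 : ℝ) L)] fun _ => c := by
  let bump : ContDiffBump (L / 2) := ⟨L / 8, L / 4, by linarith, by linarith⟩
  set φ₀ : ℝ → ℝ := bump.normed volume with hφ₀
  have hs₀ : tsupport φ₀ ⊆ Ioo 0 L := by
    rw [hφ₀, bump.tsupport_normed_eq, Real.closedBall_eq_Icc]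
    intro x hx
    simp only [bump] at hx
    constructor <;> linarith [hx.1, hx.2]
  have hc₀ : HasCompactSupport φ₀ := bump.hasCompactSupport_normed
  have hφ₀s : ContDiff ℝ ∞ φ₀ := bump.contDiff_normed
  have h1 : ∫ x, φ₀ x = 1 := bump.integral_normed
  have hne : (tsupport φ₀).Nonempty := by
    rw [hφ₀, bump.tsupport_normed_eq]
    exact ⟨L / 2, Metric.mem_closedBall_self bump.rOut_pos.le⟩
  -- Since `∫ φ₀ = 1`, this is the only possible constant. Testing with the primitive of `φ - (∫ φ)
  -- φ₀` gives `∫ φ f = (∫ φ) c` for every `φ`.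
  set c : E2 := ∫ x in Ioo 0 L, φ₀ x • f x with hcdef
  refine ⟨c, ?_⟩
  have hconst : Integrable (fun _ : ℝ => c) (volume.restrict (Ioo (0 : ℝ) L)) :=
    integrable_const c
  have key := ae_eq_zero_of_integral_test ((L2.integrable f).sub hconst)
    fun φ hφ hc hs => by
      obtain ⟨ψ, hψ, hψc, hψs, hψd⟩ := exists_test_primitive hφ hc hs hφ₀s hc₀ hs₀ hne h1
      have e1 := h ψ hψ hψc hψs
      have e2 : ∫ x in Ioo 0 L, ψ x • (0 : L2 L) x = 0 := by
        rw [integral_eq_zero_of_ae]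
        filter_upwards [Lp.coeFn_zero E2 2 (volume.restrict (Ioo (0 : ℝ) L))] with x hx
        rw [hx]
        simp
      rw [e2, neg_zero] at e1
      simp only [hψd, sub_smul, mul_smul] at e1
      have e4 : Integrable (fun x => (∫ y, φ y) • φ₀ x • f x)
        (volume.restrict (Ioo (0 : ℝ) L)) :=
        (integrable_smul_L2 hφ₀s.continuous hc₀ f).smul (∫ y, φ y)
      rw [integral_sub (integrable_smul_L2 hφ.continuous hc f) e4, integral_smul,
        ← hcdef, sub_eq_zero] at e1
      have e3 : ∫ x in Ioo 0 L, φ x • c = (∫ y, φ y) • c := by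
        rw [integral_smul_const, setIntegral_eq_integral_of_forall_compl_eq_zero]
        exact fun x hx => image_eq_zero_of_notMem_tsupport fun h' => hx (hs h')
      simp only [Pi.sub_apply, smul_sub]
      rw [integral_sub (integrable_smul_L2 hφ.continuous hc f)
        ((hφ.continuous.integrable_of_hasCompactSupport hc).restrict.smul_const c), e1, e3, sub_self]
  filter_upwards [key] with x hx
  exact sub_eq_zero.1 hx

/-- The primitive of `d` also has weak derivative `d`, so it differs from `f` by a constant. -/
theorem HasWeakDeriv.exists_isPrimitive (hL : 0 < L) {f d : L2 L} (h : HasWeakDeriv f d) :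
    ∃ u : ℝ → E2, IsPrimitive L u d ∧ f =ᵐ[volume.restrict (Ioo (0 : ℝ) L)] u := by
  have hp : IsPrimitive L (primitive 0 d) d := isPrimitive_primitive 0 d
  have hm := memLp_of_continuousOn (hp.continuousOn hL.le)
  have h2 := h.sub (hp.hasWeakDeriv hL.le hm.coeFn_toLp)
  rw [sub_self] at h2
  obtain ⟨c, hc⟩ := h2.exists_const hL
  refine ⟨primitive c d, isPrimitive_primitive c d, ?_⟩
  filter_upwards [hc, hm.coeFn_toLp, Lp.coeFn_sub f hm.toLp] with x h3 h4 h5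
  rw [h5, Pi.sub_apply, h4, sub_eq_iff_eq_add] at h3
  rw [h3]
  ext i
  simp [primitive]

theorem IsPrimitive.of_hasDerivAt {u u' : ℝ → E2} (hu : ∀ x, HasDerivAt u (u' x) x)
    (hu' : Continuous u') : IsPrimitive L u u' := by
  intro i x _
  have h1 : ∀ x, HasDerivAt (fun x => u x i) (u' x i) x := fun x =>
    ((EuclideanSpace.proj (𝕜 := ℂ) i).restrictScalars ℝ).hasFDerivAt.comp_hasDerivAt x (hu x)
  have h2 : Continuous fun x => u' x i := by fun_prop
  rw [intervalIntegral.integral_eq_sub_of_hasDerivAt (fun s _ => h1 s) (h2.intervalIntegrable _ _)]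
  ring

theorem IsPrimitive.congr_ae {u d d' : ℝ → E2} (h : IsPrimitive L u d)
    (hd : d =ᵐ[volume.restrict (Ioo (0 : ℝ) L)] d') : IsPrimitive L u d' := by
  intro i x hx
  rw [h i x hx]
  congr 1
  apply intervalIntegral.integral_congr_ae_restrict
  rw [uIoc_of_le hx.1, ← restrict_Ioo_eq_restrict_Ioc]
  filter_upwards [ae_restrict_of_ae_restrict_of_subset (Ioo_subset_Ioo_right hx.2) hd] with s hs
  rw [hs]

end Representatives

/-! ### The Fourier basis of `L²((0,L); ℂ²)` -/

section FourierBasis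

variable {L : ℝ}

local notation "E2" => EuclideanSpace ℂ (Fin 2)

/-- The frequency `πn/L`. -/
noncomputable def freq (L : ℝ) (n : ℤ) : ℝ := Real.pi * n / L

/-- The function `(e^{iπnx/L}, e^{-iπnx/L}) / √(2L)`. -/
noncomputable def modeFun (L : ℝ) (n : ℤ) (x : ℝ) : E2 :=
  !₂[(√(2 * L) : ℂ)⁻¹ * Complex.exp (freq L n * x * Complex.I),
    (√(2 * L) : ℂ)⁻¹ * Complex.exp (-(freq L n * x * Complex.I))]

theorem continuous_modeFun (L : ℝ) (n : ℤ) : Continuous (modeFun L n) := by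
  refine (PiLp.continuous_toLp 2 _).comp (continuous_pi fun i => ?_)
  fin_cases i
  · simp only [Fin.zero_eta, Matrix.cons_val_zero]
    fun_prop
  · simp only [Fin.mk_one, Matrix.cons_val_one]
    fun_prop

/-- The class of `modeFun` in `L²`. -/
noncomputable def modeVec (L : ℝ) (n : ℤ) : L2 L :=
  (memLp_of_continuousOn (continuous_modeFun L n).continuousOn).toLp

theorem coeFn_modeVec (n : ℤ) :
    modeVec L n =ᵐ[volume.restrict (Ioo (0 : ℝ) L)] modeFun L n :=
  MemLp.coeFn_toLp _

theorem inner_eq_integral (f g : L2 L) :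
    inner ℂ f g = ∫ x in Ioo 0 L, inner ℂ (f x) (g x) := rfl

theorem inner_E2 (u v : E2) :
    inner ℂ u v = (starRingEnd ℂ) (u 0) * v 0 + (starRingEnd ℂ) (u 1) * v 1 := by
  simp [PiLp.inner_apply, mul_comm]

theorem conj_exp_mul_I (r x : ℝ) :
    (starRingEnd ℂ) (Complex.exp (r * x * Complex.I)) = Complex.exp (-(r * x * Complex.I)) := by
  rw [← Complex.exp_conj]
  simp

theorem conj_exp_neg_mul_I (r x : ℝ) :
    (starRingEnd ℂ) (Complex.exp (-(r * x * Complex.I))) = Complex.exp (r * x * Complex.I) := by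
  rw [← Complex.exp_conj]
  simp

theorem inner_modeFun (n : ℤ) (x : ℝ) (v : E2) :
    inner ℂ (modeFun L n x) v = (√(2 * L) : ℂ)⁻¹ * (Complex.exp (-(freq L n * x * Complex.I)) * v 0
      + Complex.exp (freq L n * x * Complex.I) * v 1) := by
  rw [inner_E2]
  simp only [modeFun, Fin.isValue, PiLp.toLp_apply, Matrix.cons_val_zero, Matrix.cons_val_one,
    map_mul, conj_exp_mul_I, conj_exp_neg_mul_I, map_inv₀, Complex.conj_ofReal]
  ring

theorem inner_modeVec (hL : 0 < L) (n : ℤ) (f : L2 L) :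
    inner ℂ (modeVec L n) f = (√(2 * L) : ℂ)⁻¹ * ∫ x in (0 : ℝ)..L,
      (Complex.exp (-(freq L n * x * Complex.I)) * f x 0
        + Complex.exp (freq L n * x * Complex.I) * f x 1) := by
  rw [inner_eq_integral, ← setIntegral_Ioo_eq hL.le, ← integral_const_mul]
  apply integral_congr_ae
  filter_upwards [coeFn_modeVec n] with x hx
  rw [hx, inner_modeFun]

/-- The sum is `2cos(πkx/L)`. A single exponential does not integrate to zero over `(0,L)` for odd
`k`, so orthogonality of the modes needs both components together. -/
theorem integral_exp_add_exp (hL : 0 < L) (k : ℤ) :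
    ∫ x in (0 : ℝ)..L, (Complex.exp (-(freq L k * x * Complex.I))
      + Complex.exp (freq L k * x * Complex.I)) = if k = 0 then (2 * L : ℂ) else 0 := by
  have h1 : ∀ x : ℝ, Complex.exp (-(freq L k * x * Complex.I))
      + Complex.exp (freq L k * x * Complex.I) = ((2 * Real.cos (freq L k * x) : ℝ) : ℂ) := by
    intro x
    push_cast
    rw [Complex.two_cos, add_comm]
    simp [neg_mul]
  simp_rw [h1]
  rw [intervalIntegral.integral_ofReal, intervalIntegral.integral_const_mul]
  split_ifs with hk
  · simp [hk, freq]
  · have hf : freq L k ≠ 0 := by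
      unfold freq
      have : (k : ℝ) ≠ 0 := by exact_mod_cast hk
      have := Real.pi_ne_zero
      positivity
    rw [intervalIntegral.integral_comp_mul_left _ hf, integral_cos]
    have h2 : freq L k * L = k * Real.pi := by
      unfold freq
      field_simp
    rw [h2, Real.sin_int_mul_pi]
    simp

theorem orthonormal_modeVec (hL : 0 < L) : Orthonormal ℂ (modeVec L) := by
  rw [orthonormal_iff_ite]
  intro m n
  have hs : (√(2 * L) : ℂ) * √(2 * L) = 2 * L := by
    rw [← Complex.ofReal_mul, Real.mul_self_sqrt (by positivity)]
    simp
  have hs0 : (√(2 * L) : ℂ) ≠ 0 := by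
    have : √(2 * L) ≠ 0 := (Real.sqrt_pos.2 (by positivity)).ne'
    exact_mod_cast this
  rw [inner_modeVec hL]
  have h : ∫ x in (0 : ℝ)..L, (Complex.exp (-(freq L m * x * Complex.I)) * modeVec L n x 0
        + Complex.exp (freq L m * x * Complex.I) * modeVec L n x 1)
      = ∫ x in (0 : ℝ)..L, (√(2 * L) : ℂ)⁻¹ * (Complex.exp (-(freq L (m - n) * x * Complex.I))
        + Complex.exp (freq L (m - n) * x * Complex.I)) := by
    rw [← setIntegral_Ioo_eq hL.le, ← setIntegral_Ioo_eq hL.le]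
    apply integral_congr_ae
    filter_upwards [coeFn_modeVec n] with x hx
    have e : (freq L (m - n) : ℂ) = freq L m - freq L n := by
      simp only [freq]
      push_cast
      ring
    have e1 : Complex.exp (-(freq L (m - n) * x * Complex.I))
        = Complex.exp (-(freq L m * x * Complex.I)) * Complex.exp (freq L n * x * Complex.I) := by
      rw [← Complex.exp_add, e]
      congr 1
      ring
    have e2 : Complex.exp (freq L (m - n) * x * Complex.I)
        = Complex.exp (freq L m * x * Complex.I) * Complex.exp (-(freq L n * x * Complex.I)) := by
      rw [← Complex.exp_add, e]
      congr 1
      ring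
    rw [hx, e1, e2]
    simp only [modeFun, Fin.isValue, PiLp.toLp_apply, Matrix.cons_val_zero, Matrix.cons_val_one]
    ring
  rw [h, intervalIntegral.integral_const_mul, integral_exp_add_exp hL, ← mul_assoc, ← mul_inv, hs]
  have hL' : (L : ℂ) ≠ 0 := by exact_mod_cast hL.ne'
  simp only [sub_eq_zero]
  split_ifs
  · field_simp
  · simp

/-- Glues two functions on `(0,L)` into one on `(-L,L)`, so that pairs of components can be treated
by scalar Fourier series. -/
theorem intervalIntegrable_reflect (hL : 0 < L) {V : Type*} [NormedAddCommGroup V]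
    [NormedSpace ℝ V] {A B : ℝ → V} (hA : IntervalIntegrable A volume 0 L)
    (hB : IntervalIntegrable B volume 0 L) :
    IntervalIntegrable (fun y => if 0 < y then A y else B (-y)) volume (-L) L ∧
    ∫ y in (-L)..L, (if 0 < y then A y else B (-y))
      = (∫ y in (0 : ℝ)..L, A y) + ∫ y in (0 : ℝ)..L, B y := by
  have e1 : EqOn (fun y => if 0 < y then A y else B (-y)) A (uIoc 0 L) := fun y hy => by
    rw [uIoc_of_le hL.le] at hy
    simp [hy.1]
  have e2 : EqOn (fun y => if 0 < y then A y else B (-y)) (fun y => B (-y)) (uIoc (-L) 0) :=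
    fun y hy => by
      rw [uIoc_of_le (by linarith)] at hy
      simp [not_lt.2 hy.2]
  have hB' : IntervalIntegrable (fun y => B (-y)) volume (-L) 0 := by
    simpa using (IntervalIntegrable.iff_comp_neg (by simp)).1 hB.symm
  have i1 := hA.congr e1.symm
  have i2 := hB'.congr e2.symm
  refine ⟨i2.trans i1, ?_⟩
  rw [← intervalIntegral.integral_add_adjacent_intervals i2 i1,
    intervalIntegral.integral_congr_ae (ae_of_all _ e1),
    intervalIntegral.integral_congr_ae (ae_of_all _ e2), intervalIntegral.integral_comp_neg,
    neg_zero, neg_neg, add_comm]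

/-- Completeness by unfolding: let `w` be `f₁` on `(0,L)` and the reflection of `f₂` on `(-L,0)`. Up
to a nonzero factor, the coefficients of `f` are the Fourier coefficients of `w`, so Parseval's
identity on `(-L,L)` forces the norm of `f` to vanish. -/
theorem eq_zero_of_inner_modeVec (hL : 0 < L) {f : L2 L}
    (h : ∀ n, inner ℂ (modeVec L n) f = 0) : f = 0 := by
  set w : ℝ → ℂ := fun y => if 0 < y then f y 0 else f (-y) 1 with hw
  have hfm : ∀ i : Fin 2, StronglyMeasurable fun y => f y i := fun i =>
    (EuclideanSpace.proj (𝕜 := ℂ) i).continuous.comp_stronglyMeasurable (Lp.stronglyMeasurable f)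
  have hwm : StronglyMeasurable w :=
    StronglyMeasurable.ite (measurableSet_lt measurable_const measurable_id) (hfm 0)
      ((hfm 1).comp_measurable measurable_neg)
  have hsq : ∀ i : Fin 2, IntervalIntegrable (fun x => ‖f x i‖ ^ 2) volume 0 L := fun i => by
    rw [intervalIntegrable_iff_integrableOn_Ioo_of_le hL.le]
    have h1 : MemLp (fun x => f x i) 2 (volume.restrict (Ioo (0 : ℝ) L)) :=
      (EuclideanSpace.proj (𝕜 := ℂ) i).comp_memLp' (Lp.memLp f)
    exact h1.integrable_norm_pow (by norm_num)
  obtain ⟨hi, hint⟩ := intervalIntegrable_reflect hL (hsq 0) (hsq 1)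
  have hnorm : (fun y => ‖w y‖ ^ 2) = fun y => if 0 < y then ‖f y 0‖ ^ 2 else ‖f (-y) 1‖ ^ 2 := by
    funext y
    simp only [hw]
    split_ifs <;> rfl
  have hLL : -L < L := by linarith
  have hw2 : MemLp w 2 (volume.restrict (Ioc (-L) L)) := by
    rw [memLp_two_iff_integrable_sq_norm hwm.aestronglyMeasurable, hnorm]
    exact (intervalIntegrable_iff_integrableOn_Ioc_of_le hLL.le).1 hi
  have hcoef : ∀ n, fourierCoeffOn hLL w n = 0 := fun n => by
    rw [fourierCoeffOn_eq_integral]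
    have h1 : ∀ y : ℝ, fourier (-n) (y : AddCircle (L - -L))
        = Complex.exp (-(freq L n * y * Complex.I)) := fun y => by
      rw [fourier_coe_apply]
      congr 1
      have hL' : (L : ℂ) ≠ 0 := by exact_mod_cast hL.ne'
      simp only [freq]
      push_cast
      field_simp
      ring
    have hA : IntervalIntegrable (fun y => Complex.exp (-(freq L n * y * Complex.I)) * f y 0)
        volume 0 L :=
      (L2.intervalIntegrable_apply hL.le f 0).continuousOn_mul (by fun_prop)
    have hB : IntervalIntegrable (fun y => Complex.exp (freq L n * y * Complex.I) * f y 1)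
        volume 0 L :=
      (L2.intervalIntegrable_apply hL.le f 1).continuousOn_mul (by fun_prop)
    have h2 : ∀ y : ℝ, fourier (-n) (y : AddCircle (L - -L)) • w y
        = if 0 < y then Complex.exp (-(freq L n * y * Complex.I)) * f y 0
          else Complex.exp (freq L n * (-y : ℝ) * Complex.I) * f (-y) 1 := fun y => by
      rw [h1]
      simp only [hw]
      split_ifs
      · rfl
      · rw [smul_eq_mul]
        congr 2
        push_cast
        ring
    have hs0 : (√(2 * L) : ℂ)⁻¹ ≠ 0 := by
      have : √(2 * L) ≠ 0 := (Real.sqrt_pos.2 (by positivity)).ne'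
      exact inv_ne_zero (by exact_mod_cast this)
    have h3 := h n
    rw [inner_modeVec hL, intervalIntegral.integral_add hA hB] at h3
    simp_rw [h2]
    rw [(intervalIntegrable_reflect hL hA hB).2, (mul_eq_zero.1 h3).resolve_left hs0, smul_zero]
  have hsum := hasSum_sq_fourierCoeffOn hLL hw2
  simp only [hcoef, norm_zero, ne_eq, OfNat.ofNat_ne_zero, not_false_eq_true, zero_pow] at hsum
  have h0 := hsum.unique hasSum_zero
  rw [hnorm, hint, smul_eq_zero] at h0
  have h0 := h0.resolve_left (inv_ne_zero (by linarith))
  rw [← inner_self_eq_zero (𝕜 := ℂ), inner_eq_integral, setIntegral_Ioo_eq hL.le]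
  have h4 : ∀ x, inner ℂ (f x) (f x) = ((‖f x 0‖ ^ 2 + ‖f x 1‖ ^ 2 : ℝ) : ℂ) := fun x => by
    rw [inner_E2]
    push_cast
    rw [Complex.conj_mul', Complex.conj_mul']
  simp_rw [h4]
  rw [intervalIntegral.integral_ofReal, intervalIntegral.integral_add (hsq 0) (hsq 1), h0]
  simp

/-- The Hilbert basis `(e^{iπnx/L}, e^{-iπnx/L}) / √(2L)` of `L²((0,L); ℂ²)`. -/
noncomputable def modeBasis (hL : 0 < L) : HilbertBasis ℤ ℂ (L2 L) :=
  HilbertBasis.mkOfOrthogonalEqBot (orthonormal_modeVec hL) (by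
    rw [Submodule.eq_bot_iff]
    intro x hx
    apply eq_zero_of_inner_modeVec hL
    intro n
    exact (Submodule.mem_orthogonal _ _).1 hx _ (Submodule.subset_span ⟨n, rfl⟩))

theorem coe_modeBasis (hL : 0 < L) (n : ℤ) : modeBasis hL n = modeVec L n := by
  rw [modeBasis, HilbertBasis.coe_mkOfOrthogonalEqBot]

end FourierBasis

/-! ### The weight that diagonalises the uncoupled system -/

section Weight

variable {L : ℝ}

local notation "E2" => EuclideanSpace ℂ (Fin 2)

/-- The matrix `((a, b), (c, d))` as an operator on `ℂ²`. -/
noncomputable def mat2 (a b c d : ℂ) : E2 →L[ℂ] E2 :=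
  LinearMap.toContinuousLinearMap
    { toFun := fun u => !₂[a * u 0 + b * u 1, c * u 0 + d * u 1]
      map_add' := fun u v => by
        ext i
        fin_cases i <;> simp <;> ring
      map_smul' := fun r u => by
        ext i
        fin_cases i <;> simp <;> ring }

@[simp] theorem mat2_apply_zero (a b c d : ℂ) (u : E2) :
    mat2 a b c d u 0 = a * u 0 + b * u 1 := rfl

@[simp] theorem mat2_apply_one (a b c d : ℂ) (u : E2) :
    mat2 a b c d u 1 = c * u 0 + d * u 1 := rfl

theorem ext_E2 {u v : E2} (h0 : u 0 = v 0) (h1 : u 1 = v 1) : u = v := by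
  ext i
  fin_cases i
  · exact h0
  · exact h1

variable (L) in
/-- The operator of multiplication by `Λ = diag(1,-1)`. -/
noncomputable def lamOp : L2 L →L[ℂ] L2 L := constOp L (mat2 1 0 0 (-1))

variable (L) in
/-- The operator of multiplication by `m(x) J`. -/
noncomputable def couplOp (m : C(ℝ, ℝ)) : L2 L →L[ℂ] L2 L :=
  smulOp L m ∘L constOp L (mat2 0 (1 / 3) (-(1 / 3)) 0)

variable (L) in
/-- The operator of multiplication by `diag(m₀(x), m₁(x))`. -/
noncomputable def diagOp (m₀ m₁ : C(ℝ, ℝ)) : L2 L →L[ℂ] L2 L :=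
  smulOp L m₀ ∘L constOp L (mat2 1 0 0 0) + smulOp L m₁ ∘L constOp L (mat2 0 0 0 1)

theorem coeFn_lamOp (f : L2 L) : ∀ᵐ x ∂volume.restrict (Ioo (0 : ℝ) L),
    lamOp L f x 0 = f x 0 ∧ lamOp L f x 1 = -f x 1 := by
  filter_upwards [coeFn_constOp (mat2 1 0 0 (-1)) f] with x hx
  rw [lamOp, hx]
  simp

theorem coeFn_couplOp (m : C(ℝ, ℝ)) (f : L2 L) : ∀ᵐ x ∂volume.restrict (Ioo (0 : ℝ) L),
    couplOp L m f x 0 = m x * (1 / 3 * f x 1) ∧ couplOp L m f x 1 = m x * (-(1 / 3) * f x 0) := by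
  filter_upwards [coeFn_constOp (mat2 0 (1 / 3) (-(1 / 3)) 0) f,
    coeFn_smulOp m (constOp L (mat2 0 (1 / 3) (-(1 / 3)) 0) f)] with x hx hx'
  rw [couplOp, ContinuousLinearMap.comp_apply, hx', hx]
  simp

theorem coeFn_diagOp (m₀ m₁ : C(ℝ, ℝ)) (f : L2 L) : ∀ᵐ x ∂volume.restrict (Ioo (0 : ℝ) L),
    diagOp L m₀ m₁ f x 0 = m₀ x * f x 0 ∧ diagOp L m₀ m₁ f x 1 = m₁ x * f x 1 := by
  filter_upwards [coeFn_constOp (mat2 1 0 0 0) f, coeFn_constOp (mat2 0 0 0 1) f,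
    coeFn_smulOp m₀ (constOp L (mat2 1 0 0 0) f), coeFn_smulOp m₁ (constOp L (mat2 0 0 0 1) f),
    Lp.coeFn_add (smulOp L m₀ (constOp L (mat2 1 0 0 0) f))
      (smulOp L m₁ (constOp L (mat2 0 0 0 1) f))] with x h1 h2 h3 h4 h5
  rw [diagOp, add_apply, ContinuousLinearMap.comp_apply,
    ContinuousLinearMap.comp_apply, h5, Pi.add_apply, h3, h4, h1, h2]
  simp

/-- The weight operator `diag(e^{-μx}, -e^{-μ(2L-x)})`. -/
noncomputable def weight (L μ : ℝ) : L2 L →L[ℂ] L2 L :=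
  diagOp L ⟨fun x => Real.exp (-(μ * x)), by fun_prop⟩
    ⟨fun x => -Real.exp (-(μ * (2 * L - x))), by fun_prop⟩

theorem coeFn_weight (μ : ℝ) (f : L2 L) : ∀ᵐ x ∂volume.restrict (Ioo (0 : ℝ) L),
    weight L μ f x 0 = Complex.exp (-(μ * x)) * f x 0 ∧
      weight L μ f x 1 = -Complex.exp (-(μ * (2 * L - x))) * f x 1 := by
  filter_upwards [coeFn_diagOp ⟨fun x => Real.exp (-(μ * x)), by fun_prop⟩
    ⟨fun x => -Real.exp (-(μ * (2 * L - x))), by fun_prop⟩ f] with x hx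
  rw [weight, hx.1, hx.2]
  simp

theorem weight_neg_weight (μ : ℝ) (f : L2 L) : weight L (-μ) (weight L μ f) = f := by
  apply Lp.ext
  filter_upwards [coeFn_weight μ f, coeFn_weight (-μ) (weight L μ f)] with x h1 h2
  apply ext_E2
  · rw [h2.1, h1.1, ← mul_assoc, ← Complex.exp_add]
    simp
  · rw [h2.2, h1.2, ← mul_assoc, neg_mul_neg, ← Complex.exp_add]
    simp

theorem weight_weight_neg (μ : ℝ) (f : L2 L) : weight L μ (weight L (-μ) f) = f := by
  simpa using weight_neg_weight (-μ) f

theorem inner_weight_left (μ : ℝ) (f g : L2 L) :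
    inner ℂ (weight L μ f) g = inner ℂ f (weight L μ g) := by
  rw [inner_eq_integral, inner_eq_integral]
  apply integral_congr_ae
  filter_upwards [coeFn_weight μ f, coeFn_weight μ g] with x h1 h2
  rw [inner_E2, inner_E2, h1.1, h1.2, h2.1, h2.2]
  simp only [map_mul, map_neg, ← Complex.exp_conj, Complex.conj_ofReal, map_sub, map_ofNat]
  ring

theorem inner_couplOp_left (m : C(ℝ, ℝ)) (f g : L2 L) :
    inner ℂ (couplOp L m f) g = -inner ℂ f (couplOp L m g) := by
  rw [inner_eq_integral, inner_eq_integral, ← integral_neg]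
  apply integral_congr_ae
  filter_upwards [coeFn_couplOp m f, coeFn_couplOp m g] with x h1 h2
  rw [inner_E2, inner_E2, h1.1, h1.2, h2.1, h2.2]
  simp only [map_mul, map_neg, Complex.conj_ofReal, map_div₀, map_one, map_ofNat]
  ring

theorem exp_pi_int_mul_I (n : ℤ) :
    Complex.exp (Real.pi * n * Complex.I) = Complex.exp (-(Real.pi * n * Complex.I)) := by
  have h : (Real.pi * n * Complex.I : ℂ)
      = -(Real.pi * n * Complex.I) + n * (2 * Real.pi * Complex.I) := by ring
  conv_lhs => rw [h]
  exact Complex.exp_periodic.int_mul n _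

theorem inner_modeVec_weight (hL : 0 < L) (μ : ℝ) (n : ℤ) (f : L2 L) :
    inner ℂ (modeVec L n) (weight L μ f) = (√(2 * L) : ℂ)⁻¹ * ∫ x in (0 : ℝ)..L,
      (Complex.exp (-kap μ (freq L n) * x) * f x 0
        - Complex.exp (-(2 * μ * L)) * Complex.exp (kap μ (freq L n) * x) * f x 1) := by
  rw [inner_modeVec hL, ← setIntegral_Ioo_eq hL.le, ← setIntegral_Ioo_eq hL.le]
  congr 1
  apply integral_congr_ae
  filter_upwards [coeFn_weight μ f] with x hx
  rw [hx.1, hx.2, ← mul_assoc, ← mul_assoc, mul_neg, ← Complex.exp_add, ← Complex.exp_add,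
    ← Complex.exp_add, neg_mul, ← sub_eq_add_neg]
  congr 3
  · simp only [kap]
    ring
  · simp only [kap]
    ring

/-- The weighted uncoupled operator `Λ ∂ₓ` with the boundary conditions of the target system is
diagonal in the basis `modeVec`. -/
theorem inner_modeVec_weight_lamOp (hL : 0 < L) (μ : ℝ) {u : ℝ → E2} {f d : L2 L}
    (hu : IsPrimitive L u d) (hfu : f =ᵐ[volume.restrict (Ioo (0 : ℝ) L)] u)
    (h0 : u 0 0 = -(Real.exp (-2 * μ * L) : ℂ) * u 0 1) (hLbc : u L 1 = -u L 0) (n : ℤ) :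
    inner ℂ (modeVec L n) (weight L μ (lamOp L d))
      = kap μ (freq L n) * inner ℂ (modeVec L n) (weight L μ f) := by
  set κ := kap μ (freq L n) with hκ
  set r := Complex.exp (-(2 * μ * L)) with hr
  have hd : ∀ i, IntervalIntegrable (fun x => d x i) volume 0 L :=
    L2.intervalIntegrable_apply hL.le d
  have huc : ContinuousOn u (uIcc 0 L) := by
    rw [uIcc_of_le hL.le]
    exact hu.continuousOn hL.le
  have hui : ∀ i, ContinuousOn (fun x => u x i) (uIcc 0 L) := fun i =>
    ((EuclideanSpace.proj (𝕜 := ℂ) i).continuous.comp_continuousOn huc)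
  have hE : ∀ c : ℂ, Continuous fun x : ℝ => Complex.exp (c * x) := fun c => by fun_prop
  -- Both components are integrated by parts against the exponentials from the weighted inner
  -- product; only the boundary terms remain to be matched.
  have e1 := integral_deriv_mul_add_mul_deriv hL.le (hasDerivAt_exp_kap (-κ)) (by fun_prop) (hd 0)
    (hu 0)
  have e2 := integral_deriv_mul_add_mul_deriv hL.le (hasDerivAt_exp_kap κ) (by fun_prop) (hd 1)
    (hu 1)
  have i1 : ∀ c i, IntervalIntegrable (fun x : ℝ => Complex.exp (c * x) * u x i) volume 0 L :=
    fun c i => ((hE c).continuousOn.mul (hui i)).intervalIntegrable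
  have i2 : ∀ c i, IntervalIntegrable (fun x : ℝ => Complex.exp (c * x) * d x i) volume 0 L :=
    fun c i => (hd i).continuousOn_mul (hE c).continuousOn
  have split : ∀ c i, ∫ x in (0 : ℝ)..L,
      (Complex.exp (c * x) * c * u x i + Complex.exp (c * x) * d x i)
      = c * (∫ x in (0 : ℝ)..L, Complex.exp (c * x) * u x i)
        + ∫ x in (0 : ℝ)..L, Complex.exp (c * x) * d x i := fun c i => by
    rw [← intervalIntegral.integral_const_mul,
      ← intervalIntegral.integral_add ((i1 c i).const_mul c) (i2 c i)]
    refine intervalIntegral.integral_congr fun x _ => ?_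
    simp only
    ring
  rw [split] at e1 e2
  have f1 : ∫ x in (0 : ℝ)..L, (Complex.exp (-κ * x) * lamOp L d x 0
      - r * Complex.exp (κ * x) * lamOp L d x 1)
      = (∫ x in (0 : ℝ)..L, Complex.exp (-κ * x) * d x 0)
        + r * ∫ x in (0 : ℝ)..L, Complex.exp (κ * x) * d x 1 := by
    rw [← intervalIntegral.integral_const_mul,
      ← intervalIntegral.integral_add (i2 _ 0) ((i2 _ 1).const_mul r), ← setIntegral_Ioo_eq hL.le,
      ← setIntegral_Ioo_eq hL.le]
    apply integral_congr_ae
    filter_upwards [coeFn_lamOp d] with x hx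
    rw [hx.1, hx.2]
    ring
  have f2 : ∫ x in (0 : ℝ)..L, (Complex.exp (-κ * x) * f x 0 - r * Complex.exp (κ * x) * f x 1)
      = (∫ x in (0 : ℝ)..L, Complex.exp (-κ * x) * u x 0)
        - r * ∫ x in (0 : ℝ)..L, Complex.exp (κ * x) * u x 1 := by
    rw [← intervalIntegral.integral_const_mul,
      ← intervalIntegral.integral_sub (i1 _ 0) ((i1 _ 1).const_mul r), ← setIntegral_Ioo_eq hL.le,
      ← setIntegral_Ioo_eq hL.le]
    apply integral_congr_ae
    filter_upwards [hfu] with x hx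
    rw [hx]
    ring
  have hb0 : u 0 0 = -r * u 0 1 := by
    rw [h0, hr]
    push_cast
    congr 3
    ring
  -- This is the characteristic equation `e^{-2κL} = e^{-2μL}` of the uncoupled problem.
  have hbL : Complex.exp (-κ * L) = r * Complex.exp (κ * L) := by
    have hL' : (L : ℂ) ≠ 0 := by exact_mod_cast hL.ne'
    have g1 : -κ * L = -(μ * L) + -(Real.pi * n * Complex.I) := by
      simp only [hκ, kap, freq]
      push_cast
      field_simp
      ring
    have g2 : -(2 * μ * L) + κ * L = -(μ * L) + Real.pi * n * Complex.I := by
      simp only [hκ, kap, freq]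
      push_cast
      field_simp
      ring
    rw [hr, ← Complex.exp_add, g1, g2, Complex.exp_add, Complex.exp_add, exp_pi_int_mul_I]
  rw [inner_modeVec_weight hL, inner_modeVec_weight hL, f1, f2]
  rw [hLbc] at e2
  simp only [Complex.ofReal_zero, mul_zero, Complex.exp_zero, one_mul] at e1 e2
  -- In the first identity plus `r` times the second, the boundary terms are `(e^{-κL} - r e^{κL})
  -- u₁(L)` and `-(u₁(0) + r u₂(0))`; both vanish.
  have key := congrArg₂ (fun a b => a + r * b) e1 e2
  simp only [hb0, hbL] at key
  linear_combination (√(2 * L) : ℂ)⁻¹ * key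

end Weight

/-! ### The target operator and weak solutions in the weighted Fourier basis -/

section Target

variable {L μ γ : ℝ}

local notation "E2" => EuclideanSpace ℂ (Fin 2)

theorem lamOp_lamOp (f : L2 L) : lamOp L (lamOp L f) = f := by
  apply Lp.ext
  filter_upwards [coeFn_lamOp f, coeFn_lamOp (lamOp L f)] with x h1 h2
  apply ext_E2
  · rw [h2.1, h1.1]
  · rw [h2.2, h1.2, neg_neg]

theorem targetOp_iff_eq {m : C(ℝ, ℝ)} (hm : ∀ x ∈ Ioo 0 L, m x = delta L γ x) {f g : L2 L} :
    TargetOp L μ γ f g ↔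
      ∃ d : L2 L, HasWeakDeriv f d ∧ BoundaryCond L μ f ∧ g = lamOp L d + couplOp L m f := by
  have key : ∀ d : L2 L, (lamOp L d + couplOp L m f : L2 L)
      =ᵐ[volume.restrict (Ioo (0 : ℝ) L)] fun x => diffExpr L γ x (f x) (d x) := fun d => by
    filter_upwards [coeFn_lamOp d, coeFn_couplOp m f, Lp.coeFn_add (lamOp L d) (couplOp L m f),
      ae_restrict_mem measurableSet_Ioo] with x h1 h2 h3 hx
    rw [h3, Pi.add_apply]
    apply ext_E2
    · rw [PiLp.add_apply, h1.1, h2.1, hm x hx]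
      rfl
    · rw [PiLp.add_apply, h1.2, h2.2, hm x hx]
      rfl
  constructor
  · rintro ⟨d, h1, h2, h3⟩
    exact ⟨d, h1, h2, Lp.ext (h3.trans (key d).symm)⟩
  · rintro ⟨d, h1, h2, h3⟩
    exact ⟨d, h1, h2, by rw [h3]; exact key d⟩

theorem BoundaryCond.exists_isPrimitive (hL : 0 < L) {f d : L2 L} (hf : BoundaryCond L μ f)
    (hd : HasWeakDeriv f d) : ∃ u : ℝ → E2, IsPrimitive L u d ∧
      f =ᵐ[volume.restrict (Ioo (0 : ℝ) L)] u ∧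
      u 0 0 = -(Real.exp (-2 * μ * L) : ℂ) * u 0 1 ∧ u L 1 = -u L 0 := by
  obtain ⟨v, hv, hfv, h0, h1⟩ := hf
  obtain ⟨u, hu, hfu⟩ := hd.exists_isPrimitive hL
  have hvu : v =ᵐ[volume.restrict (Icc (0 : ℝ) L)] u := by
    rw [← restrict_Ioo_eq_restrict_Icc]
    exact hfv.symm.trans hfu
  have heq := Measure.eqOn_Icc_of_ae_eq volume hL.ne hvu hv (hu.continuousOn hL.le)
  refine ⟨u, hu, hfu, ?_, ?_⟩
  · rw [← heq ⟨le_rfl, hL.le⟩, h0]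
  · rw [← heq ⟨hL.le, le_rfl⟩, h1]

theorem kap_ne_zero (hμ : 0 < μ) (θ : ℝ) : kap μ θ ≠ 0 := by
  intro h
  have := congrArg Complex.re h
  simp [kap] at this
  exact hμ.ne' this

/-- The boundary conditions are two linear equations for `u(0)`, uniquely solvable because `1 -
e^{-2μL} ≠ 0`. Hence the uncoupled operator is onto. -/
theorem exists_isPrimitive_bc (hL : 0 < L) (hμ : 0 < μ) (d : L2 L) :
    ∃ u : ℝ → E2, IsPrimitive L u d ∧
      u 0 0 = -(Real.exp (-2 * μ * L) : ℂ) * u 0 1 ∧ u L 1 = -u L 0 := by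
  set r : ℂ := (Real.exp (-2 * μ * L) : ℂ) with hr
  have hr1 : 1 - r ≠ 0 := by
    have h1 : Real.exp (-2 * μ * L) < 1 := by
      rw [← Real.exp_zero]
      exact Real.exp_lt_exp.2 (by nlinarith [mul_pos hμ hL])
    rw [hr, sub_ne_zero]
    exact fun h => h1.ne' (Complex.ofReal_injective (by rw [← h, Complex.ofReal_one]))
  set a : Fin 2 → ℂ := fun i => ∫ s in (0 : ℝ)..L, d s i with ha
  -- The value `u₂(0)`: with `u(0) = (-r c1, c1)` the condition at `L` reads `c1 + a 1 = r c1 - a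
  -- 0`.
  set c1 : ℂ := -(a 0 + a 1) / (1 - r) with hc1
  refine ⟨primitive !₂[-r * c1, c1] d, isPrimitive_primitive _ _, ?_, ?_⟩
  · simp [primitive]
  · have h : c1 * (1 - r) = -(a 0 + a 1) := div_mul_cancel₀ _ hr1
    simp only [primitive, Fin.isValue, PiLp.toLp_apply, Matrix.cons_val_one, Matrix.cons_val_zero]
    change c1 + a 1 = -(-r * c1 + a 0)
    linear_combination h

/-- Converse of the diagonalisation: the domain prescribed by coefficients contains no more than the
`H¹` functions satisfying the boundary conditions. The solution `u` of `Λu' = h` with these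
conditions has the same weighted coefficients as `f`, because no `κ_n` is zero. -/
theorem hasWeakDeriv_of_inner_modeVec (hL : 0 < L) (hμ : 0 < μ) {f h : L2 L}
    (H : ∀ n, inner ℂ (modeVec L n) (weight L μ h)
      = kap μ (freq L n) * inner ℂ (modeVec L n) (weight L μ f)) :
    HasWeakDeriv f (lamOp L h) ∧ BoundaryCond L μ f := by
  obtain ⟨u, hu, h0, h1⟩ := exists_isPrimitive_bc hL hμ (lamOp L h)
  have huc := hu.continuousOn hL.le
  have hm := (memLp_of_continuousOn huc).coeFn_toLp
  have hf : f = (memLp_of_continuousOn huc).toLp := by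
    rw [← weight_neg_weight μ f, ← weight_neg_weight μ (memLp_of_continuousOn huc).toLp]
    congr 1
    apply ext_inner_hilbertBasis (modeBasis hL)
    intro n
    rw [coe_modeBasis]
    have := inner_modeVec_weight_lamOp hL μ hu hm h0 h1 n
    rw [lamOp_lamOp, H] at this
    exact mul_left_cancel₀ (kap_ne_zero hμ _) this
  rw [← hf] at hm
  exact ⟨hu.hasWeakDeriv hL.le hm, u, huc, hm, h0, h1⟩

/-- The coupling term in the weighted coordinates. -/
noncomputable def weightedCoupl (L μ : ℝ) (m : C(ℝ, ℝ)) : L2 L →L[ℂ] L2 L :=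
  weight L μ ∘L couplOp L m ∘L weight L (-μ)

theorem weightedCoupl_weight (m : C(ℝ, ℝ)) (f : L2 L) :
    weightedCoupl L μ m (weight L μ f) = weight L μ (couplOp L m f) := by
  simp [weightedCoupl, weight_neg_weight]

theorem targetOp_iff_inGraph (hL : 0 < L) (hμ : 0 < μ) {m : C(ℝ, ℝ)}
    (hm : ∀ x ∈ Ioo 0 L, m x = delta L γ x) {f g : L2 L} :
    TargetOp L μ γ f g ↔ InGraph (modeBasis hL) (freq L) μ (weightedCoupl L μ m)
      (weight L μ f) (weight L μ g) := by
  rw [targetOp_iff_eq hm]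
  simp only [InGraph, coe_modeBasis, weightedCoupl_weight]
  constructor
  · rintro ⟨d, h1, h2, rfl⟩ n
    obtain ⟨u, hu, hfu, h0, hbc⟩ := h2.exists_isPrimitive hL h1
    rw [map_add, inner_add_right, inner_modeVec_weight_lamOp hL μ hu hfu h0 hbc]
  · intro H
    obtain ⟨h1, h2⟩ := hasWeakDeriv_of_inner_modeVec hL hμ (f := f) (h := g - couplOp L m f)
      fun n => by rw [map_sub, inner_sub_right, H, add_sub_cancel_right]
    exact ⟨_, h1, h2, by rw [lamOp_lamOp, sub_add_cancel]⟩

theorem pairing_eq_inner {ψ : ℝ → E2} (hψ : MemLp ψ 2 (volume.restrict (Ioo (0 : ℝ) L)))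
    (f : L2 L) : pairing f ψ = inner ℂ hψ.toLp f := by
  rw [inner_eq_integral, pairing]
  apply integral_congr_ae
  filter_upwards [hψ.coeFn_toLp] with x hx
  rw [hx]

theorem conj_kap (μ θ : ℝ) : (starRingEnd ℂ) (kap μ θ) = -kap (-μ) θ := by
  simp only [kap, map_add, map_mul, Complex.conj_ofReal, Complex.conj_I, Complex.ofReal_neg]
  ring

/-- The test functions of the weak formulation in the weighted Fourier basis. -/
theorem exists_test_vectors (hL : 0 < L) {m : C(ℝ, ℝ)} (hm : ∀ x ∈ Ioo 0 L, m x = delta L γ x)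
    {ψ : ℝ → E2} (hψ : ContDiff ℝ 1 ψ) (h0 : ψ 0 0 = -(Real.exp (2 * μ * L) : ℂ) * ψ 0 1)
    (h1 : ψ L 1 = -ψ L 0) :
    ∃ η ξ : L2 L, (weight L μ η =ᵐ[volume.restrict (Ioo (0 : ℝ) L)] ψ) ∧
      (∀ n, inner ℂ (modeBasis hL n) ξ
        = -(starRingEnd ℂ) (kap μ (freq L n)) * inner ℂ (modeBasis hL n) η) ∧
      ∀ f : L2 L, pairing f ψ = inner ℂ η (weight L μ f) ∧
        pairing f (fun x => diffExpr L γ x (ψ x) (deriv ψ x))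
          = inner ℂ ξ (weight L μ f) - inner ℂ η (weightedCoupl L μ m (weight L μ f)) := by
  have hψc : Continuous ψ := hψ.continuous
  have hdc : Continuous (deriv ψ) := hψ.continuous_deriv_one
  have hM := memLp_of_continuousOn (L := L) hψc.continuousOn
  have hM' := memLp_of_continuousOn (L := L) hdc.continuousOn
  have hprim : IsPrimitive L ψ hM'.toLp := (IsPrimitive.of_hasDerivAt
    (fun x => (hψ.differentiable_one x).hasDerivAt) hdc).congr_ae hM'.coeFn_toLp.symm
  -- The weight is self-adjoint with inverse `weight L (-μ)`, so pairing `f` with `ψ` is pairing the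
  -- weighted `f` with the inverse weight applied to `ψ`.
  refine ⟨weight L (-μ) hM.toLp, weight L (-μ) (lamOp L hM'.toLp), ?_, fun n => ?_, fun f => ⟨?_, ?_⟩⟩
  · rw [weight_weight_neg]
    exact hM.coeFn_toLp
  · rw [coe_modeBasis, conj_kap, neg_neg]
    -- The adjoint boundary conditions are the original ones with `-μ` in place of `μ`, and `kap
    -- (-μ) θ` is minus the conjugate of `kap μ θ`.
    refine inner_modeVec_weight_lamOp hL (-μ) hprim hM.coeFn_toLp ?_ h1 n
    rw [h0]
    congr 3
    ring_nf
  · rw [inner_weight_left, weight_neg_weight, pairing_eq_inner hM]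
  · rw [weightedCoupl_weight, inner_weight_left, inner_weight_left, weight_neg_weight,
      weight_neg_weight, sub_eq_add_neg, ← inner_couplOp_left, ← inner_add_left,
      inner_eq_integral, pairing]
    apply integral_congr_ae
    filter_upwards [hM.coeFn_toLp, hM'.coeFn_toLp, coeFn_lamOp hM'.toLp,
      coeFn_couplOp m hM.toLp, Lp.coeFn_add (lamOp L hM'.toLp) (couplOp L m hM.toLp),
      ae_restrict_mem measurableSet_Ioo] with x e1 e2 e3 e4 e5 hx
    congr 1
    rw [e5, Pi.add_apply]
    apply ext_E2
    · rw [PiLp.add_apply, e3.1, e4.1, e1, e2, hm x hx]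
      rfl
    · rw [PiLp.add_apply, e3.2, e4.2, e1, e2, hm x hx]
      rfl

end Target

/-! ### Existence, uniqueness and decay in `L²`. -/

section Evolution

variable {L μ γ : ℝ}

local notation "E2" => EuclideanSpace ℂ (Fin 2)

/-- The weak formulation of the target system for a function with values in `L²`. -/
def SolvesWeakly (L μ γ : ℝ) (z₀ : L2 L) (z : ℝ → L2 L) : Prop :=
  ∀ ψ : ℝ → E2, ContDiff ℝ 1 ψ →
    ψ 0 0 = -(Real.exp (2 * μ * L) : ℂ) * ψ 0 1 → ψ L 1 = -ψ L 0 →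
    ∀ t : ℝ, 0 ≤ t → pairing (z t) ψ = pairing z₀ ψ
      + ∫ s in (0 : ℝ)..t, pairing (z s) (fun x => diffExpr L γ x (ψ x) (deriv ψ x))

/-- The solution operator of the target system on `L²`. -/
noncomputable def targetEvol (hL : 0 < L) (μ : ℝ) (m : C(ℝ, ℝ)) (t : ℝ) (z : L2 L) : L2 L :=
  weight L (-μ) (evol (modeBasis hL) (freq L) μ (weightedCoupl L μ m) t (weight L μ z))

theorem weight_targetEvol (hL : 0 < L) (m : C(ℝ, ℝ)) (t : ℝ) (z : L2 L) :
    weight L μ (targetEvol hL μ m t z)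
      = evol (modeBasis hL) (freq L) μ (weightedCoupl L μ m) t (weight L μ z) :=
  weight_weight_neg μ _

theorem continuousOn_targetEvol (hL : 0 < L) (m : C(ℝ, ℝ)) (z : L2 L) :
    ContinuousOn (fun t => targetEvol hL μ m t z) (Ici 0) :=
  (weight L (-μ)).continuous.comp_continuousOn (evol_spec _ _ _ _ _).continuousOn

theorem targetEvol_zero (hL : 0 < L) (m : C(ℝ, ℝ)) (z : L2 L) : targetEvol hL μ m 0 z = z := by
  rw [targetEvol, (evol_spec _ _ _ _ _).initial, weight_neg_weight]

theorem solvesWeakly_targetEvol (hL : 0 < L) {m : C(ℝ, ℝ)}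
    (hm : ∀ x ∈ Ioo 0 L, m x = delta L γ x) (z : L2 L) :
    SolvesWeakly L μ γ z fun t => targetEvol hL μ m t z := by
  intro ψ hψ h0 h1 t ht
  obtain ⟨η, ξ, -, hξ, hp⟩ := exists_test_vectors hL hm hψ h0 h1
  simp only [hp, weight_targetEvol]
  exact (evol_spec (modeBasis hL) (freq L) μ (weightedCoupl L μ m) (weight L μ z)).inner_eq hξ ht

/-- The eigenfunctions of the adjoint of the uncoupled operator. -/
noncomputable def adjMode (L μ : ℝ) (n : ℤ) (x : ℝ) : E2 :=
  !₂[Complex.exp (-(μ * x)) * modeFun L n x 0, -Complex.exp (-(μ * (2 * L - x))) * modeFun L n x 1]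

theorem contDiff_adjMode (n : ℤ) : ContDiff ℝ 1 (adjMode L μ n) := by
  have h0 : ∀ c : ℂ, ContDiff ℝ 1 fun x : ℝ => Complex.exp (c * x) := fun c =>
    Complex.contDiff_exp.comp (contDiff_const.mul Complex.ofRealCLM.contDiff)
  refine (PiLp.continuousLinearEquiv 2 ℝ (fun _ : Fin 2 => ℂ)).symm.contDiff.comp
    (contDiff_pi.2 fun i => ?_)
  fin_cases i
  · have h := ((h0 (-μ)).mul (contDiff_const (c := (√(2 * L) : ℂ)⁻¹))).mul
      (h0 (freq L n * Complex.I))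
    refine (congrArg (ContDiff ℝ 1) (funext fun x => ?_)).mpr h
    change Complex.exp (-(μ * x)) * ((√(2 * L) : ℂ)⁻¹ * Complex.exp (freq L n * x * Complex.I)) = _
    simp only [← mul_assoc, neg_mul]
    rw [mul_right_comm _ _ (x : ℂ)]
  · have h := (((h0 μ).mul (contDiff_const (c := -Complex.exp (-(2 * μ * L))))).mul
      (contDiff_const (c := (√(2 * L) : ℂ)⁻¹))).mul (h0 (-(freq L n * Complex.I)))
    refine (congrArg (ContDiff ℝ 1) (funext fun x => ?_)).mpr h
    change -Complex.exp (-(μ * (2 * L - x)))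
      * ((√(2 * L) : ℂ)⁻¹ * Complex.exp (-(freq L n * x * Complex.I))) = _
    rw [mul_neg, ← Complex.exp_add, mul_assoc]
    ring_nf

theorem adjMode_bc_zero (n : ℤ) :
    adjMode L μ n 0 0 = -(Real.exp (2 * μ * L) : ℂ) * adjMode L μ n 0 1 := by
  have h : Complex.exp (2 * μ * L) * Complex.exp (-(μ * (2 * L))) = 1 := by
    rw [← Complex.exp_add]
    ring_nf
    exact Complex.exp_zero
  simp only [adjMode, modeFun, Fin.isValue, PiLp.toLp_apply, Matrix.cons_val_zero,
    Matrix.cons_val_one, Complex.ofReal_zero, mul_zero, zero_mul, neg_zero, Complex.exp_zero,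
    sub_zero, mul_one, Complex.ofReal_exp]
  push_cast
  linear_combination (-(√(2 * L) : ℂ)⁻¹) * h

theorem adjMode_bc_right (hL : 0 < L) (n : ℤ) : adjMode L μ n L 1 = -adjMode L μ n L 0 := by
  have hL' : (L : ℂ) ≠ 0 := by exact_mod_cast hL.ne'
  have h : (freq L n * L * Complex.I : ℂ) = Real.pi * n * Complex.I := by
    simp only [freq]
    push_cast
    field_simp
  simp only [adjMode, modeFun, Fin.isValue, PiLp.toLp_apply, Matrix.cons_val_zero,
    Matrix.cons_val_one, h, exp_pi_int_mul_I]
  ring_nf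

/-- The weight maps each basis mode to a smooth function satisfying the adjoint boundary conditions.
Testing with these functions isolates the equation of each weighted coefficient, so uniqueness of
modal solutions transfers to weak solutions. -/
theorem SolvesWeakly.isModalSol (hL : 0 < L) {m : C(ℝ, ℝ)}
    (hm : ∀ x ∈ Ioo 0 L, m x = delta L γ x) {z₀ : L2 L} {z : ℝ → L2 L}
    (hc : ContinuousOn z (Ici 0)) (h : SolvesWeakly L μ γ z₀ z) :
    IsModalSol (modeBasis hL) (freq L) μ (weightedCoupl L μ m) (weight L μ z₀)
      fun t => weight L μ (z t) := by
  refine ⟨(weight L μ).continuous.comp_continuousOn hc, fun n t ht => ?_⟩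
  obtain ⟨η, ξ, hη, hξ, hp⟩ := exists_test_vectors (μ := μ) hL hm (contDiff_adjMode n)
    (adjMode_bc_zero n) (adjMode_bc_right hL n)
  have hη' : η = modeBasis hL n := by
    rw [coe_modeBasis, ← weight_neg_weight μ η, ← weight_neg_weight μ (modeVec L n)]
    congr 1
    apply Lp.ext
    filter_upwards [hη, coeFn_weight μ (modeVec L n), coeFn_modeVec (L := L) n] with x h1 h2 h3
    rw [h1]
    apply ext_E2
    · rw [h2.1, h3]
      rfl
    · rw [h2.2, h3]
      rfl
  have hξ' : ξ = -(starRingEnd ℂ) (kap μ (freq L n)) • modeBasis hL n := by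
    classical
    apply ext_inner_hilbertBasis (modeBasis hL)
    intro k
    rw [hξ, hη', inner_smul_right, orthonormal_iff_ite.1 (modeBasis hL).orthonormal]
    split_ifs with hk
    · rw [hk]
    · simp
  have := h _ (contDiff_adjMode n) (adjMode_bc_zero n) (adjMode_bc_right hL n) t ht
  simp only [hp] at this
  rw [hη'] at this
  rw [this]
  congr 1
  refine intervalIntegral.integral_congr fun s _ => ?_
  simp only [hξ']
  rw [inner_smul_left, map_neg, Complex.conj_conj]
  ring

theorem SolvesWeakly.eq_targetEvol (hL : 0 < L) {m : C(ℝ, ℝ)}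
    (hm : ∀ x ∈ Ioo 0 L, m x = delta L γ x) {z₀ : L2 L} {z : ℝ → L2 L}
    (hc : ContinuousOn z (Ici 0)) (h : SolvesWeakly L μ γ z₀ z) {t : ℝ} (ht : 0 ≤ t) :
    z t = targetEvol hL μ m t z₀ := by
  rw [targetEvol, ← (h.isModalSol hL hm hc).unique (evol_spec _ _ _ _ _) ht, weight_neg_weight]

theorem targetOp_targetEvol (hL : 0 < L) (hμ : 0 < μ) {m : C(ℝ, ℝ)}
    (hm : ∀ x ∈ Ioo 0 L, m x = delta L γ x) {f g : L2 L} (hfg : TargetOp L μ γ f g) {t : ℝ}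
    (ht : 0 ≤ t) : TargetOp L μ γ (targetEvol hL μ m t f) (targetEvol hL μ m t g) ∧
      HasDerivWithinAt (fun s => targetEvol hL μ m s f) (-targetEvol hL μ m t g) (Ici 0) t := by
  rw [targetOp_iff_inGraph hL hμ hm] at hfg ⊢
  obtain ⟨h1, h2⟩ := evol_graph hfg ht
  rw [weight_targetEvol, weight_targetEvol]
  refine ⟨h1, ?_⟩
  have := ((weight L (-μ)).restrictScalars ℝ).hasFDerivAt.comp_hasDerivWithinAt t h2
  rw [targetEvol, ← map_neg]
  exact this

theorem norm_targetEvol_le (hL : 0 < L) (m : C(ℝ, ℝ)) (z : L2 L) {t : ℝ} (ht : 0 ≤ t) :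
    ‖targetEvol hL μ m t z‖ ≤ ‖weight L (-μ)‖ * ‖weight L μ‖
      * Real.exp (-(μ - ‖weightedCoupl L μ m‖) * t) * ‖z‖ := by
  have h1 := (evol_spec (modeBasis hL) (freq L) μ (weightedCoupl L μ m) (weight L μ z)).norm_le ht
  have h2 := (weight L μ).le_opNorm z
  calc _ ≤ ‖weight L (-μ)‖ * (Real.exp (-(μ - ‖weightedCoupl L μ m‖) * t)
          * (‖weight L μ‖ * ‖z‖)) := by
        refine ((weight L (-μ)).le_opNorm _).trans (mul_le_mul_of_nonneg_left ?_ (norm_nonneg _))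
        exact h1.trans (mul_le_mul_of_nonneg_left h2 (Real.exp_pos _).le)
    _ = _ := by ring

variable (L μ) in
theorem exists_norm_weightedCoupl_le : ∃ M : ℝ, 0 < M ∧ ∀ (m : C(ℝ, ℝ)) (c : ℝ), 0 ≤ c →
    (∀ x ∈ Ioo 0 L, |m x| ≤ c) → ‖weightedCoupl L μ m‖ ≤ M * c := by
  -- The bound involves only `L` and `μ`, so `M` can be fixed before `γ`; the summand `1` only
  -- ensures `M > 0`.
  refine ⟨‖weight L μ‖ * ‖constOp L (mat2 0 (1 / 3) (-(1 / 3)) 0)‖ * ‖weight L (-μ)‖ + 1,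
    by positivity, fun m c hc h => ?_⟩
  have h1 := norm_smulOp_le hc h
  calc ‖weightedCoupl L μ m‖ ≤ ‖weight L μ‖ * (‖smulOp L m‖
        * ‖constOp L (mat2 0 (1 / 3) (-(1 / 3)) 0)‖ * ‖weight L (-μ)‖) := by
        refine (ContinuousLinearMap.opNorm_comp_le _ _).trans ?_
        gcongr
        refine (ContinuousLinearMap.opNorm_comp_le _ _).trans ?_
        gcongr
        exact ContinuousLinearMap.opNorm_comp_le _ _
    _ ≤ ‖weight L μ‖ * (c * ‖constOp L (mat2 0 (1 / 3) (-(1 / 3)) 0)‖ * ‖weight L (-μ)‖) := by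
        gcongr
    _ ≤ _ := by
        rw [add_mul, one_mul]
        linarith [mul_comm c ‖constOp L (mat2 0 (1 / 3) (-(1 / 3)) 0)‖,
          show ‖weight L μ‖ * (c * ‖constOp L (mat2 0 (1 / 3) (-(1 / 3)) 0)‖ * ‖weight L (-μ)‖)
            = ‖weight L μ‖ * ‖constOp L (mat2 0 (1 / 3) (-(1 / 3)) 0)‖ * ‖weight L (-μ)‖ * c by
            ring]

end Evolution

/-! ### Operators on `H^p((0,L); ℂ²)` -/

section Sobolev

variable {L μ γ : ℝ} {p : ℕ}

local notation "E2" => EuclideanSpace ℂ (Fin 2)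

/-- The `k`-th weak derivative of an element of `H^p`. -/
noncomputable def Hp.derivL (L : ℝ) (p : ℕ) (k : Fin (p + 1)) : Hp L p →L[ℂ] L2 L :=
  (PiLp.proj 2 (fun _ : Fin (p + 1) => L2 L) k : _ →L[ℂ] L2 L) ∘L (sobolev L p).subtypeL

theorem Hp.hasWeakDeriv (u : Hp L p) (k : Fin p) :
    HasWeakDeriv (Hp.derivL L p k.castSucc u) (Hp.derivL L p k.succ u) := u.2 k

/-- Uniqueness of weak derivatives, applied order by order: an element of `H^p` is determined by its
underlying function. -/
theorem Hp.ext_toL2 {u v : Hp L p} (h : u.toL2 = v.toL2) : u = v := by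
  have key : ∀ k, Hp.derivL L p k u = Hp.derivL L p k v := fun k => by
    induction k using Fin.induction with
    | zero => exact h
    | succ k ih =>
      have h1 := u.hasWeakDeriv k
      rw [ih] at h1
      exact h1.unique (v.hasWeakDeriv k)
  apply Subtype.ext
  ext1 k
  exact key k

/-- The map into `H^p` with prescribed weak derivatives. -/
noncomputable def liftHp {V : Type*} [NormedAddCommGroup V] [NormedSpace ℂ V]
    (A : Fin (p + 1) → V →L[ℂ] L2 L)
    (h : ∀ v (k : Fin p), HasWeakDeriv (A k.castSucc v) (A k.succ v)) : V →L[ℂ] Hp L p :=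
  ((PiLp.continuousLinearEquiv 2 ℂ (fun _ : Fin (p + 1) => L2 L)).symm.toContinuousLinearMap ∘L
    ContinuousLinearMap.pi A).codRestrict (sobolev L p) h

/-- The weak derivative `H^{p+1} → H^p`. -/
noncomputable def Hp.tail (L : ℝ) (p : ℕ) : Hp L (p + 1) →L[ℂ] Hp L p :=
  liftHp (fun k => Hp.derivL L (p + 1) k.succ) fun u k => u.hasWeakDeriv k.succ

/-- The inclusion `H^{p+1} → H^p`. -/
noncomputable def Hp.init (L : ℝ) (p : ℕ) : Hp L (p + 1) →L[ℂ] Hp L p :=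
  liftHp (fun k => Hp.derivL L (p + 1) k.castSucc) fun u k => u.hasWeakDeriv k.castSucc

theorem Hp.toL2_init (u : Hp L (p + 1)) : (Hp.init L p u).toL2 = u.toL2 := rfl

theorem Hp.hasWeakDeriv_tail (u : Hp L (p + 1)) : HasWeakDeriv u.toL2 (Hp.tail L p u).toL2 :=
  u.hasWeakDeriv 0

/-- A function in `L²` whose weak derivative is in `H^p` is in `H^{p+1}`. -/
noncomputable def consHp {V : Type*} [NormedAddCommGroup V] [NormedSpace ℂ V]
    (A₀ : V →L[ℂ] L2 L) (A₁ : V →L[ℂ] Hp L p) (h : ∀ v, HasWeakDeriv (A₀ v) (A₁ v).toL2) :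
    V →L[ℂ] Hp L (p + 1) :=
  liftHp (Fin.cases A₀ fun k => Hp.derivL L p k ∘L A₁) fun v k => by
    cases k using Fin.cases with
    | zero => exact h v
    | succ k => exact (A₁ v).hasWeakDeriv k

/-- The action of a constant matrix on `H^p`. -/
noncomputable def constHp (L : ℝ) (p : ℕ) (A : E2 →L[ℂ] E2) : Hp L p →L[ℂ] Hp L p :=
  liftHp (fun k => constOp L A ∘L Hp.derivL L p k) fun u k => (u.hasWeakDeriv k).constOp A

theorem toL2_constHp (A : E2 →L[ℂ] E2) (u : Hp L p) :
    (constHp L p A u).toL2 = constOp L A u.toL2 := rfl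

/-- Induction on the Leibniz rule `(mf)' = m'f + mf'`. The multiplier is generalised because `m'`
also has to act on the lower space. -/
theorem exists_smulHp (L : ℝ) (p : ℕ) (m : C(ℝ, ℝ)) (hm : ContDiff ℝ ∞ m) :
    ∃ M : Hp L p →L[ℂ] Hp L p, ∀ u, (M u).toL2 = smulOp L m u.toL2 := by
  induction p generalizing m with
  | zero =>
    exact ⟨liftHp (fun _ => smulOp L m ∘L Hp.derivL L 0 0) fun _ k => k.elim0, fun u => rfl⟩
  | succ p ih =>
    obtain ⟨hd, hm'⟩ := contDiff_infty_iff_deriv.1 hm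
    obtain ⟨M₁, h₁⟩ := ih ⟨deriv m, hm'.continuous⟩ hm'
    obtain ⟨M₂, h₂⟩ := ih m hm
    refine ⟨consHp (smulOp L m ∘L Hp.derivL L (p + 1) 0)
      (M₁ ∘L Hp.init L p + M₂ ∘L Hp.tail L p) fun u => ?_, fun u => rfl⟩
    have h := (Hp.hasWeakDeriv_tail u).smulOp (m' := ⟨deriv m, hm'.continuous⟩) hm fun _ => rfl
    change HasWeakDeriv (smulOp L m u.toL2) ((M₁ (Hp.init L p u)).toL2 + (M₂ (Hp.tail L p u)).toL2)
    rw [h₁, h₂]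
    exact h

theorem exists_couplHp (L : ℝ) (p : ℕ) (m : C(ℝ, ℝ)) (hm : ContDiff ℝ ∞ m) :
    ∃ M : Hp L p →L[ℂ] Hp L p, ∀ u, (M u).toL2 = couplOp L m u.toL2 := by
  obtain ⟨M, h⟩ := exists_smulHp L p m hm
  exact ⟨M ∘L constHp L p (mat2 0 (1 / 3) (-(1 / 3)) 0), fun u => h _⟩

/-- The subspace on which one operator is the weak derivative of another. -/
def weakDerivSubmodule {V : Type*} [NormedAddCommGroup V] [NormedSpace ℂ V]
    (A₀ A₁ : V →L[ℂ] L2 L) : Submodule ℂ V where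
  carrier := {v | HasWeakDeriv (A₀ v) (A₁ v)}
  zero_mem' := by simpa using hasWeakDeriv_zero L
  add_mem' := fun {a b} ha hb => by simpa using HasWeakDeriv.add ha hb
  smul_mem' := fun c v hv => by simpa using HasWeakDeriv.smul c hv

/-- On the subspace where the weak-derivative relation holds, reconstruction of the `H^{p+1}`
function is a bounded linear map. Continuity in time and decay thus pass from the data to the
reconstructed function. -/
theorem exists_consHp_subtype {V : Type*} [NormedAddCommGroup V] [NormedSpace ℂ V]
    (A₀ : V →L[ℂ] L2 L) (A₁ : V →L[ℂ] Hp L p) :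
    ∃ (K : ℝ) (R : {v // HasWeakDeriv (A₀ v) (A₁ v).toL2} → Hp L (p + 1)), 0 ≤ K ∧ Continuous R ∧
      (∀ v, (R v).toL2 = A₀ v) ∧ ∀ v, ‖R v‖ ≤ K * ‖(v : V)‖ := by
  let W := weakDerivSubmodule A₀ (Hp.derivL L p 0 ∘L A₁)
  let R : W →L[ℂ] Hp L (p + 1) := consHp (A₀ ∘L W.subtypeL) (A₁ ∘L W.subtypeL) fun v => v.2
  exact ⟨‖R‖, R, norm_nonneg R, R.continuous, fun v => rfl, fun v => R.le_opNorm v⟩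

theorem Compatible.of_succ {f : L2 L} (h : Compatible L μ γ (p + 1) f) : Compatible L μ γ p f := by
  induction p generalizing f with
  | zero => trivial
  | succ p ih =>
    obtain ⟨g, hg, hc⟩ := h
    exact ⟨g, hg, ih hc⟩

/-- Regularity and decay of the solutions of the target system in `H^p`. -/
theorem exists_targetEvol_Hp (hL : 0 < L) (hμ : 0 < μ) {m : C(ℝ, ℝ)} (hms : ContDiff ℝ ∞ m)
    (hm : ∀ x ∈ Ioo 0 L, m x = delta L γ x) (p : ℕ) :
    ∃ C : ℝ, 0 ≤ C ∧ ∀ z₀ : Hp L p, Compatible L μ γ p z₀.toL2 →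
      ∃ z : ℝ → Hp L p, ContinuousOn z (Ici 0) ∧
        (∀ t, 0 ≤ t → (z t).toL2 = targetEvol hL μ m t z₀.toL2) ∧
        ∀ t, 0 ≤ t →
          ‖z t‖ ≤ C * Real.exp (-(μ - ‖weightedCoupl L μ m‖) * t) * ‖z₀‖ := by
  induction p with
  | zero =>
    set E : L2 L →L[ℂ] Hp L 0 := liftHp (fun _ => ContinuousLinearMap.id ℂ _) fun _ k => k.elim0
    refine ⟨‖E‖ * (‖weight L (-μ)‖ * ‖weight L μ‖) * ‖Hp.derivL L 0 0‖, by positivity,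
      fun z₀ _ => ⟨fun t => E (targetEvol hL μ m t z₀.toL2), ?_, fun t _ => rfl, fun t ht => ?_⟩⟩
    · exact E.continuous.comp_continuousOn (continuousOn_targetEvol hL m _)
    · calc _ ≤ ‖E‖ * (‖weight L (-μ)‖ * ‖weight L μ‖
            * Real.exp (-(μ - ‖weightedCoupl L μ m‖) * t) * (‖Hp.derivL L 0 0‖ * ‖z₀‖)) := by
            refine (E.le_opNorm _).trans (mul_le_mul_of_nonneg_left ?_ E.opNorm_nonneg)
            refine (norm_targetEvol_le hL m _ ht).trans (mul_le_mul_of_nonneg_left ?_ ?_)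
            · exact (Hp.derivL L 0 0).le_opNorm z₀
            · positivity
        _ = _ := by ring
  | succ p ih =>
    obtain ⟨C, hC, H⟩ := ih
    obtain ⟨M, hM⟩ := exists_couplHp L p m hms
    set Λ := constHp L p (mat2 1 0 0 (-1)) with hΛ
    set π₁ : Hp L p × Hp L p →L[ℂ] Hp L p := ContinuousLinearMap.fst ℂ _ _ with hπ₁
    set π₂ : Hp L p × Hp L p →L[ℂ] Hp L p := ContinuousLinearMap.snd ℂ _ _ with hπ₂
    -- The derivative recovered from a pair `(z, Ãz)`: as `Λ² = 1`, it is `Λ(Ãz - δJz)`.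
    set D : Hp L p × Hp L p →L[ℂ] Hp L p := Λ ∘L (π₂ - M ∘L π₁) with hD
    obtain ⟨K, R, hK, hRc, hR, hRn⟩ := exists_consHp_subtype (Hp.derivL L p 0 ∘L π₁) D
    -- This is `Ã` as a bounded operator from `H^{p+1}` to `H^p`.
    set A : Hp L (p + 1) →L[ℂ] Hp L p := Λ ∘L Hp.tail L p + M ∘L Hp.init L p with hA
    refine ⟨K * (C * ‖Hp.init L p‖ + C * ‖A‖), by positivity, fun z₀ hz₀ => ?_⟩
    obtain ⟨g, hg, hcg⟩ := id hz₀
    have hAg : (A z₀).toL2 = g := by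
      obtain ⟨d, h1, -, h3⟩ := (targetOp_iff_eq hm).1 hg
      rw [h3, h1.unique (Hp.hasWeakDeriv_tail z₀)]
      change (Λ (Hp.tail L p z₀)).toL2 + (M (Hp.init L p z₀)).toL2 = _
      rw [hM, toL2_constHp]
      rfl
    -- The induction hypothesis is used twice, for `z₀` and for `Ãz₀`; both are compatible of order
    -- `p`.
    obtain ⟨F, hFc, hF, hFn⟩ := H (Hp.init L p z₀) hz₀.of_succ
    obtain ⟨G, hGc, hG, hGn⟩ := H (A z₀) (by rwa [hAg])
    rw [hAg] at hG
    have hmem : ∀ t, 0 ≤ t → HasWeakDeriv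
        ((Hp.derivL L p 0 ∘L π₁) (F t, G t)) (D (F t, G t)).toL2 := fun t ht => by
      obtain ⟨d, h1, -, h3⟩ := (targetOp_iff_eq hm).1 (targetOp_targetEvol hL hμ hm hg ht).1
      change HasWeakDeriv (F t).toL2 (Λ (G t - M (F t))).toL2
      have h4 : (Λ (G t - M (F t))).toL2 = lamOp L ((G t).toL2 - (M (F t)).toL2) := rfl
      rw [h4, hM, hF t ht, hG t ht, Hp.toL2_init, h3, add_sub_cancel_right, lamOp_lamOp]
      exact h1
    refine ⟨fun t => R ⟨(F (max t 0), G (max t 0)), hmem _ (le_max_right _ _)⟩, ?_,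
      fun t ht => ?_, fun t ht => ?_⟩
    · have h1 : Continuous fun t : ℝ => F (max t 0) :=
        hFc.comp_continuous (by fun_prop) fun t => le_max_right t 0
      have h2 : Continuous fun t : ℝ => G (max t 0) :=
        hGc.comp_continuous (by fun_prop) fun t => le_max_right t 0
      exact (hRc.comp ((h1.prodMk h2).subtype_mk _)).continuousOn
    · rw [hR]
      change (F (max t 0)).toL2 = _
      rw [max_eq_left ht, hF t ht, Hp.toL2_init]
    · simp only [max_eq_left ht]
      set e := Real.exp (-(μ - ‖weightedCoupl L μ m‖) * t) with he
      have he0 : 0 < e := Real.exp_pos _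
      have h1 : ‖F t‖ ≤ C * e * (‖Hp.init L p‖ * ‖z₀‖) :=
        (hFn t ht).trans (mul_le_mul_of_nonneg_left ((Hp.init L p).le_opNorm z₀) (by positivity))
      have h2 : ‖G t‖ ≤ C * e * (‖A‖ * ‖z₀‖) :=
        (hGn t ht).trans (mul_le_mul_of_nonneg_left (A.le_opNorm z₀) (by positivity))
      have h3 : ‖(F t, G t)‖ ≤ ‖F t‖ + ‖G t‖ :=
        max_le (le_add_of_nonneg_right (norm_nonneg _)) (le_add_of_nonneg_left (norm_nonneg _))
      calc _ ≤ K * (C * e * (‖Hp.init L p‖ * ‖z₀‖) + C * e * (‖A‖ * ‖z₀‖)) :=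
            (hRn _).trans (mul_le_mul_of_nonneg_left (by linarith) hK)
        _ = _ := by ring

theorem expStable_of_norm_le (hL : 0 < L) (hμ : 0 < μ) {m : C(ℝ, ℝ)} (hms : ContDiff ℝ ∞ m)
    (hm : ∀ x ∈ Ioo 0 L, m x = delta L γ x) {lam : ℝ} (hlam : lam ≤ μ - ‖weightedCoupl L μ m‖)
    (p : ℕ) : ExpStable L μ γ p lam := by
  obtain ⟨C, hC, H⟩ := exists_targetEvol_Hp hL hμ hms hm p
  refine ⟨C + 1, by positivity, fun z₀ hz₀ => ?_⟩
  obtain ⟨z, hzc, hz, hzn⟩ := H z₀ hz₀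
  refine ⟨z, ⟨hzc, ?_, ?_⟩, fun hp t ht => ?_, fun y hy t ht => ?_, fun t ht => ?_⟩
  · apply Hp.ext_toL2
    rw [hz 0 le_rfl, targetEvol_zero]
  · intro ψ hψ h0 h1 t ht
    rw [hz t ht, solvesWeakly_targetEvol hL hm z₀.toL2 ψ hψ h0 h1 t ht]
    congr 1
    refine intervalIntegral.integral_congr fun s hs => ?_
    rw [uIcc_of_le ht] at hs
    simp only [hz s hs.1]
  · obtain ⟨q, rfl⟩ := Nat.exists_eq_add_of_le' hp
    obtain ⟨g, hg, -⟩ := hz₀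
    obtain ⟨h1, h2⟩ := targetOp_targetEvol hL hμ hm hg ht
    rw [hz t ht]
    exact ⟨_, h1, h2.congr (fun s hs => hz s hs) (hz t ht)⟩
  · apply Hp.ext_toL2
    have hyc : ContinuousOn (fun t => (y t).toL2) (Ici 0) :=
      (Hp.derivL L p 0).continuous.comp_continuousOn hy.continuousOn
    have hyw : SolvesWeakly L μ γ z₀.toL2 fun t => (y t).toL2 := hy.weak
    rw [hz t ht, ← hyw.eq_targetEvol hL hm hyc ht]
  · have h1 : Real.exp (-(μ - ‖weightedCoupl L μ m‖) * t) ≤ Real.exp (-lam * t) := by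
      apply Real.exp_le_exp.2
      nlinarith
    refine (hzn t ht).trans (mul_le_mul_of_nonneg_right ?_ (norm_nonneg _))
    exact mul_le_mul (by linarith) h1 (Real.exp_pos _).le (by positivity)

end Sobolev

/-! ### The coupling coefficient -/

section Coupling

variable {L γ : ℝ}

/-- A cutoff equal to `0` for `y ≤ 1/4` and to `1` for `y ≥ 1/2` removes the singularity. It serves
to extend `δ` from `(0,L)` to a smooth function on `ℝ`, which acts on every `H^p`. -/
theorem exists_smooth_inv : ∃ ρ : ℝ → ℝ, ContDiff ℝ ∞ ρ ∧ ∀ y, 1 / 2 ≤ y → ρ y = y⁻¹ := by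
  refine ⟨fun y => Real.smoothTransition (4 * y - 1) * y⁻¹, ?_, fun y hy => ?_⟩
  · rw [contDiff_iff_contDiffAt]
    intro y
    rcases lt_or_ge y (1 / 4) with h | h
    · refine (contDiffAt_const (c := (0 : ℝ))).congr_of_eventuallyEq ?_
      filter_upwards [isOpen_Iio.mem_nhds h] with x hx
      rw [Real.smoothTransition.zero_of_nonpos (by linarith [mem_Iio.1 hx]), zero_mul]
    · refine ContDiffAt.mul ?_ (contDiffAt_id.inv (by simp only [id]; linarith))
      exact (Real.smoothTransition.contDiff.comp
        ((contDiff_const.mul contDiff_id).sub contDiff_const)).contDiffAt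
  · simp only
    rw [Real.smoothTransition.one_of_one_le (by linarith), one_mul]

/-- The denominator is affine in `x`, falling from `√(1 + γL/2)` at `0` to `√(1 - γL/2)` at `L`. -/
theorem half_le_denominator (hL : 0 < L) (hγ : 0 < γ) (h : γ * L ≤ 1) {x : ℝ}
    (hx : x ∈ Icc 0 L) : 1 / 2 ≤ √(1 + γ * L / 2) - γ * Lgam L γ * x / (2 * L) := by
  have he : 1 / 2 ≤ √(1 - γ * L / 2) := Real.le_sqrt_of_sq_le (by linarith)
  have hse : √(1 - γ * L / 2) ≤ √(1 + γ * L / 2) :=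
    Real.sqrt_le_sqrt (by nlinarith [mul_pos hγ hL])
  have h1 : γ * Lgam L γ * x / (2 * L) = (√(1 + γ * L / 2) - √(1 - γ * L / 2)) * (x / L) := by
    rw [Lgam]
    field_simp
  have h2 : x / L ≤ 1 := (div_le_one hL).2 hx.2
  rw [h1]
  nlinarith

theorem Lgam_nonneg_le (hL : 0 < L) (hγ : 0 < γ) (h : γ * L ≤ 1) :
    0 ≤ Lgam L γ ∧ Lgam L γ ≤ 2 * L := by
  have hp := mul_pos hγ hL
  have he : 0 ≤ √(1 - γ * L / 2) := Real.sqrt_nonneg _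
  have hs : 1 ≤ √(1 + γ * L / 2) := Real.one_le_sqrt.2 (by linarith)
  have he2 := Real.sq_sqrt (show 0 ≤ 1 - γ * L / 2 by linarith)
  have hs2 := Real.sq_sqrt (show 0 ≤ 1 + γ * L / 2 by linarith)
  have hse : √(1 - γ * L / 2) ≤ √(1 + γ * L / 2) := Real.sqrt_le_sqrt (by linarith)
  refine ⟨mul_nonneg (by positivity) (by linarith), ?_⟩
  -- The squares of the two roots differ by `γL`, and the sum of the roots is at least `1`.
  have h1 : √(1 + γ * L / 2) - √(1 - γ * L / 2) ≤ γ * L := by nlinarith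
  calc Lgam L γ ≤ 2 / γ * (γ * L) := mul_le_mul_of_nonneg_left h1 (by positivity)
    _ = 2 * L := by field_simp

/-- The bound `3γ` is `(3/2)·(2γ)`: the first factor comes from `L_γ ≤ 2L`, the second from the
lower bound `1/2` on the denominator. -/
theorem exists_smooth_delta (hL : 0 < L) (hγ : 0 < γ) (h : γ * L ≤ 1) :
    ∃ m : C(ℝ, ℝ), ContDiff ℝ ∞ m ∧ (∀ x ∈ Ioo 0 L, m x = delta L γ x) ∧
      ∀ x ∈ Ioo 0 L, |m x| ≤ 3 * γ := by
  obtain ⟨ρ, hρ, hρe⟩ := exists_smooth_inv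
  have hs : ContDiff ℝ ∞ fun x => -(3 * Lgam L γ / (4 * L))
      * (γ * ρ (√(1 + γ * L / 2) - γ * Lgam L γ * x / (2 * L))) := by
    refine contDiff_const.mul (contDiff_const.mul (hρ.comp ?_))
    exact contDiff_const.sub ((contDiff_const.mul contDiff_id).div_const _)
  have heq : ∀ x ∈ Ioo 0 L, -(3 * Lgam L γ / (4 * L))
      * (γ * ρ (√(1 + γ * L / 2) - γ * Lgam L γ * x / (2 * L))) = delta L γ x := fun x hx => by
    rw [hρe _ (half_le_denominator hL hγ h (Ioo_subset_Icc_self hx)), delta, div_eq_mul_inv γ]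
  refine ⟨⟨_, hs.continuous⟩, hs, heq, fun x hx => ?_⟩
  rw [ContinuousMap.coe_mk, heq x hx, delta, abs_mul, abs_neg]
  have hd := half_le_denominator hL hγ h (Ioo_subset_Icc_self hx)
  obtain ⟨h0, h2⟩ := Lgam_nonneg_le hL hγ h
  rw [abs_of_nonneg (by positivity), abs_of_nonneg (div_nonneg hγ.le (by linarith))]
  have h3 : 3 * Lgam L γ / (4 * L) ≤ 3 / 2 := by
    rw [div_le_iff₀ (by positivity)]
    linarith
  have h4 : γ / (√(1 + γ * L / 2) - γ * Lgam L γ * x / (2 * L)) ≤ 2 * γ := by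
    rw [div_le_iff₀ (by linarith)]
    nlinarith
  calc _ ≤ 3 / 2 * (2 * γ) :=
        mul_le_mul h3 h4 (div_nonneg hγ.le (by linarith)) (by norm_num)
    _ = 3 * γ := by ring

end Coupling

end WaterTank

/-! ### The threshold for `γ`. -/

theorem mainTheorem6 (L μ : ℝ) (hL : 0 < L) (hμ : 0 < μ) :
    ∃ γs : ℝ → ℝ, ContinuousOn γs (Set.Ioo 0 μ) ∧ StrictAntiOn γs (Set.Ioo 0 μ) ∧
      ∀ lam₀ ∈ Set.Ioo 0 μ, 0 < γs lam₀ ∧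
        ∀ γ ∈ Set.Ioo 0 (γs lam₀), ∀ lam ∈ Set.Icc 0 lam₀, ∀ p : ℕ,
          WaterTank.ExpStable L μ γ p lam := by
  obtain ⟨M, hM, hbound⟩ := WaterTank.exists_norm_weightedCoupl_le L μ
  have hc : 0 < 3 * M + μ * L := by positivity
  -- The two summands of the denominator serve two purposes. The term `3M` gives `3Mγ ≤ μ - lam₀`,
  -- which leaves the rate `lam₀`. The term `μL` forces `γL ≤ 1`, since `γμL < μ - lam₀ < μ`, so
  -- that `δ` is smooth and of size at most `3γ`.
  refine ⟨fun r => (μ - r) / (3 * M + μ * L), by fun_prop, fun a _ b _ hab => ?_,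
    fun lam₀ h₀ => ⟨div_pos (by linarith [h₀.2]) hc, fun γ hγ lam hlam p => ?_⟩⟩
  · exact div_lt_div_of_pos_right (by linarith) hc
  · have h1 := (lt_div_iff₀ hc).1 hγ.2
    have hγL : 0 < γ * (μ * L) := mul_pos hγ.1 (mul_pos hμ hL)
    have hγM : 0 < γ * M := mul_pos hγ.1 hM
    have h2 : γ * L ≤ 1 := by
      by_contra hlt
      nlinarith [h₀.1]
    obtain ⟨m, hms, hm, hmb⟩ := WaterTank.exists_smooth_delta hL hγ.1 h2
    have h3 := hbound m (3 * γ) (by linarith [hγ.1]) hmb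
    exact WaterTank.expStable_of_norm_le hL hμ hms hm (by linarith [hlam.2]) p
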